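/- Let $\mathfrak X=(X,\{R_i\}_{0\le i\le d})$ be a symmetric association scheme on a finite set $X$, with primitive idempotents $E_0=\frac1{|X|}J,E_1,\dots,E_d$ of its Bose–Mesner algebra. It is Q-polynomial with respect to this ordering if for each $0\le i\le d$ there is a polynomial $v_i^*$ of degree exactly $i$ with $|X|E_i=v_i^*(|X|E_1)$, the polynomial being applied entrywise. The spherical embedding with respect to $E_1$ is $x\mapsto \bar x=\sqrt{|X|/m_1}\,E_1\phi_x$, where $m_1=\operatorname{rank}E_1$ and $\phi_x$ is the characteristic vector of $x$; it maps $X$ to the unit sphere of the column space of $E_1$, which is isometric to $\mathbb R^{m_1}$. The scheme is *realized* by a polyhedron $P$ inscribed in the unit sphere of $\mathbb R^3$ if $x\mapsto\bar x$ is injective, the set $\{\bar x: x\in X\}$ is the image of the vertex set of $P$ under a linear isometric embedding of $\mathbb R^3$, and two pairs $(x,y)$, $(x',y')$ lie in the same relation $R_i$ if and only if $\langle\bar x,\bar y\rangle=\langle\bar x',\bar y'\rangle$. **Corollary 1.2.** If $\mathfrak X$ is Q-polynomial with respect to $E_0,\dots,E_d$ and is spherically embedded in $\mathbb R^3$, i.e.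 $m_1=3$, then $\mathfrak X$ is realized by one of the following polyhedra: the regular tetrahedron $(|X|=4)$, the regular octahedron $(|X|=6)$, the cube $(|X|=8)$, the regular icosahedron $(|X|=12)$. Conversely, each of these four polyhedra realizes a Q-polynomial association scheme with $m_1=3$. (These four form part of the list consisting of the regular tetrahedron, the regular octahedron, the cube, the regular icosahedron, the regular dodecahedron and the quasi-regular polyhedra of types $[3,4,3,4]$ and $[3,5,3,5]$.) -/

import Mathlib

/-- A symmetric association scheme `(X, {R_i}_{0 ≤ i ≤ d})` of class `d` on a finite set `X`. The
partition of `X × X` into the relations `R_0, …, R_d` is given by the map `rel`, which sends a pair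
to the index of the relation that contains it: `(x, y) ∈ R_i ↔ rel x y = i`. -/
structure SymmetricAssociationScheme (X : Type*) [Fintype X] (d : ℕ) where
  /-- the index of the relation that contains the pair `(x, y)` -/
  rel : X → X → Fin (d + 1)
  /-- no relation is empty -/
  nonempty : ∀ i, ∃ x y, rel x y = i
  /-- `R_0` is the diagonal -/
  diag : ∀ x y, rel x y = 0 ↔ x = y
  /-- every relation is symmetric -/
  symm : ∀ x y, rel x y = rel y x
  /-- existence of the intersection numbers `p_{ij}^k` -/
  intersection : ∀ i j k, ∃ p : ℕ, ∀ x y, rel x y = k →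
    (Finset.univ.filter fun z => rel x z = i ∧ rel z y = j).card = p

namespace SymmetricAssociationScheme

variable {X : Type*} [Fintype X] {d : ℕ}

/-- The adjacency matrix `A_i` of the relation `R_i`. -/
def adjacency (S : SymmetricAssociationScheme X d) (i : Fin (d + 1)) : Matrix X X ℝ :=
  Matrix.of fun x y => if S.rel x y = i then 1 else 0

/-- The Bose–Mesner algebra, as the real span of the adjacency matrices. -/
def boseMesner (S : SymmetricAssociationScheme X d) : Submodule ℝ (Matrix X X ℝ) :=
  Submodule.span ℝ (Set.range S.adjacency)

/-- `E_0, …, E_d` is an ordering of the primitive idempotents of the Bose–Mesner algebra, with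
`E_0 = |X|⁻¹ J`. (The Bose–Mesner algebra is commutative of dimension `d + 1`, so `d + 1` nonzero
mutually orthogonal idempotents in it are exactly its primitive idempotents.) -/
structure IsPrimitiveIdempotents [DecidableEq X] (S : SymmetricAssociationScheme X d)
    (E : Fin (d + 1) → Matrix X X ℝ) : Prop where
  mem : ∀ i, E i ∈ S.boseMesner
  ne_zero : ∀ i, E i ≠ 0
  idem : ∀ i, E i * E i = E i
  orthogonal : ∀ i j, i ≠ j → E i * E j = 0
  sum_eq_one : ∑ i, E i = 1
  zero_eq : E 0 = Matrix.of fun _ _ => (Fintype.card X : ℝ)⁻¹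

/-- The scheme is Q-polynomial with respect to the ordering `E_0, …, E_d` of its primitive
idempotents: for every `i` there is a polynomial `v` of degree exactly `i` such that
`|X| E_i = v(|X| E_1)`, where `v` is applied with respect to the entrywise product. -/
structure IsQPolynomial [DecidableEq X] (S : SymmetricAssociationScheme X d)
    (E : Fin (d + 1) → Matrix X X ℝ) : Prop where
  idempotents : S.IsPrimitiveIdempotents E
  polynomial : ∀ i : Fin (d + 1), ∃ v : Polynomial ℝ, v.degree = ((i : ℕ) : WithBot ℕ) ∧
    ∀ x y, (Fintype.card X : ℝ) * E i x y = v.eval ((Fintype.card X : ℝ) * E 1 x y)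

end SymmetricAssociationScheme

/-- The spherical embedding `x ↦ √(|X| / m) F φ_x` of `X` with respect to the idempotent `F` of
rank `m`. It takes its values in the column space of `F`, an `m`-dimensional Euclidean space. -/
noncomputable def sphericalEmbedding {X : Type*} [Fintype X] [DecidableEq X]
    (F : Matrix X X ℝ) (x : X) : EuclideanSpace ℝ X :=
  Real.sqrt ((Fintype.card X : ℝ) / (F.rank : ℝ)) •
    WithLp.toLp 2 (F.mulVec (Pi.single x 1))

/-- All points obtained from `(a, b, c)` by cyclic permutations of the coordinates and arbitrary
changes of signs. -/
def cyclicSigned (a b c : ℝ) : Set (EuclideanSpace ℝ (Fin 3)) :=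
  {v | ∃ (k : Fin 3) (ε : Fin 3 → ℤˣ), ∀ i, v i = ((ε i : ℤ) : ℝ) * ![a, b, c] (i + k)}

/-- The tetrahedron, octahedron, cube, icosahedron, dodecahedron and the two quasi-regular
polyhedra: the possible faithful spherical embeddings of symmetric association schemes in `ℝ³`
are among these. -/
inductive SchemePolyhedron : Type
  | tetrahedron
  | octahedron
  | cube
  | icosahedron
  /-- the quasi-regular polyhedron of type `[3,4,3,4]` -/
  | cuboctahedron
  | dodecahedron
  /-- the quasi-regular polyhedron of type `[3,5,3,5]` -/
  | icosidodecahedron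

namespace SchemePolyhedron

/-- Standard coordinates of the vertices, centred at the origin. -/
noncomputable def rawVertices : SchemePolyhedron → Set (EuclideanSpace ℝ (Fin 3))
  | tetrahedron => {v | v ∈ cyclicSigned 1 1 1 ∧ v 0 * v 1 * v 2 = 1}
  | octahedron => cyclicSigned 1 0 0
  | cube => cyclicSigned 1 1 1
  | icosahedron => cyclicSigned 0 1 Real.goldenRatio
  | cuboctahedron => cyclicSigned 0 1 1
  | dodecahedron =>
      cyclicSigned 1 1 1 ∪ cyclicSigned 0 Real.goldenRatio⁻¹ Real.goldenRatio
  | icosidodecahedron =>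
      cyclicSigned Real.goldenRatio 0 0 ∪
        cyclicSigned (1 / 2) (Real.goldenRatio / 2) (Real.goldenRatio ^ 2 / 2)

/-- The vertices of the polyhedron inscribed in the unit sphere. -/
noncomputable def vertices (P : SchemePolyhedron) : Set (EuclideanSpace ℝ (Fin 3)) :=
  (fun v => ‖v‖⁻¹ • v) '' P.rawVertices

end SchemePolyhedron

namespace SymmetricAssociationScheme

/-- The scheme, spherically embedded with respect to the idempotent `F`, is the polyhedron `P`: the
embedding is faithful, its image is the vertex set of a copy of `P` (inscribed in the unit sphere)
in a three-dimensional subspace, and two pairs of points lie in the same relation exactly when they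
have the same inner product. -/
structure IsRealizedBy {X : Type*} [Fintype X] [DecidableEq X] {d : ℕ}
    (S : SymmetricAssociationScheme X d) (F : Matrix X X ℝ) (P : SchemePolyhedron) : Prop where
  faithful : Function.Injective (sphericalEmbedding F)
  congruent : ∃ L : EuclideanSpace ℝ (Fin 3) →ₗᵢ[ℝ] EuclideanSpace ℝ X,
    L '' P.vertices = Set.range (sphericalEmbedding F)
  relations : ∀ x y x' y', S.rel x y = S.rel x' y' ↔
    inner ℝ (sphericalEmbedding F x) (sphericalEmbedding F y) =
      inner ℝ (sphericalEmbedding F x') (sphericalEmbedding F y')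

end SymmetricAssociationScheme

-- Identify the column space of `E 1` with Euclidean 3-space, so that X becomes a set of unit
-- vectors whose inner products determine the relations. The Q-polynomial property says that the
-- entrywise polynomials of degree at most j in |X| E_1 are the combinations of E_0, …, E_j. This
-- space is therefore stable under multiplication by the Bose–Mesner algebra, and summing a
-- polynomial of degree j in ⟨y, z⟩ over the y related to x in a fixed way gives a polynomial of
-- degree at most j in ⟨x, z⟩. These facts are collected in `IsSphericalModel`.
--
-- Contracting the third moment tensor of the points twice with a point x gives l x, with l
-- independent of x. If l ≠ 0, tensor identities in dimension three force every inner product of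
-- distinct points to be -1/3, and X is a regular tetrahedron (`inner_eq_of_cubic_ne_zero`).
--
-- If l = 0, the neighbours of a point in any relation with inner product of square less than 1,
-- projected to the plane orthogonal to that point, have the first and second moments of a circle
-- (`exists_local_moments`). Apply this to the largest inner product t < 1 between distinct points,
-- and let s be the largest inner product between two neighbours of a common point. If every
-- neighbour had only one closest fellow neighbour, the planar design would have exactly four
-- points, and its moments then contradict uniqueness. So the relevant intersection number is at
-- least two. The sphere has at most two points with prescribed inner products to x and y, hence X
-- contains both (`exists_isNearestClosed`).
--
-- This closure makes faces and vertex figures regular polygons with 3, 4 or 5 sides, since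
-- otherwise iterating the rotation would produce points that are too close. Five pairs (t, s)
-- remain (`IsNearestClosed.cases`). An edge generates all vertices of the corresponding polyhedron,
-- and the caps around them leave no room for further points. The dodecahedron is excluded because
-- the degree bound fails for cubes (`not_isNearestClosed_dodecahedron`).
--
-- For the converse, explicit tables yield four Q-polynomial schemes; the direct part realizes each
-- by one of the four polyhedra, and t tells which.

section

open Finset Matrix

-- Idempotents and the Bose–Mesner algebra

namespace Matrix

/-- The rank of an idempotent matrix over a field of characteristic zero is its trace. -/
theorem trace_eq_rank_of_isIdempotentElem {X : Type*} [Fintype X] [DecidableEq X]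
    {F : Matrix X X ℝ} (h : F * F = F) : F.trace = F.rank := by
  have h1 : IsIdempotentElem (Matrix.toLin' F) := by
    unfold IsIdempotentElem
    rw [Module.End.mul_eq_comp, ← Matrix.toLin'_mul, h]
  have h2 := (LinearMap.IsIdempotentElem.isProj_range _ h1).trace
  rw [Matrix.trace_toLin'_eq] at h2
  exact h2

end Matrix

namespace SymmetricAssociationScheme

variable {X : Type*} [Fintype X] {d : ℕ}

theorem of_rel_mem_boseMesner (S : SymmetricAssociationScheme X d) (f : Fin (d + 1) → ℝ) :
    (Matrix.of fun x y => f (S.rel x y)) ∈ S.boseMesner := by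
  have : (Matrix.of fun x y => f (S.rel x y)) = ∑ i, f i • S.adjacency i := by
    ext x y
    simp [Matrix.sum_apply, adjacency]
  rw [this]
  exact Submodule.sum_mem _ fun i _ => Submodule.smul_mem _ _ (Submodule.subset_span ⟨i, rfl⟩)

theorem exists_eq_of_rel (S : SymmetricAssociationScheme X d) {M : Matrix X X ℝ}
    (hM : M ∈ S.boseMesner) : ∃ f : Fin (d + 1) → ℝ, ∀ x y, M x y = f (S.rel x y) := by
  induction hM using Submodule.span_induction with
  | mem M h =>
    obtain ⟨i, rfl⟩ := h
    exact ⟨fun j => if j = i then 1 else 0, fun x y => rfl⟩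
  | zero => exact ⟨0, fun x y => rfl⟩
  | add M N _ _ hM hN =>
    obtain ⟨f, hf⟩ := hM
    obtain ⟨g, hg⟩ := hN
    exact ⟨f + g, fun x y => by simp [hf, hg]⟩
  | smul a M _ hM =>
    obtain ⟨f, hf⟩ := hM
    exact ⟨a • f, fun x y => by simp [hf]⟩

theorem symm_of_mem (S : SymmetricAssociationScheme X d) {M : Matrix X X ℝ}
    (hM : M ∈ S.boseMesner) (x y : X) : M x y = M y x := by
  obtain ⟨f, hf⟩ := S.exists_eq_of_rel hM
  rw [hf, hf, S.symm]

theorem adjacency_mul_apply (S : SymmetricAssociationScheme X d) (i : Fin (d + 1))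
    (M : Matrix X X ℝ) (x z : X) :
    (S.adjacency i * M) x z = ∑ y ∈ univ.filter (fun y => S.rel x y = i), M y z := by
  simp [Matrix.mul_apply, adjacency, Finset.sum_filter]

variable [DecidableEq X] {S : SymmetricAssociationScheme X d} {E : Fin (d + 1) → Matrix X X ℝ}

namespace IsPrimitiveIdempotents

theorem sum_smul_mul (h : S.IsPrimitiveIdempotents E) (c : Fin (d + 1) → ℝ) (j : Fin (d + 1)) :
    (∑ i, c i • E i) * E j = c j • E j := by
  rw [Finset.sum_mul, Finset.sum_eq_single j]
  · rw [smul_mul_assoc, h.idem]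
  · intro i _ hij
    rw [smul_mul_assoc, h.orthogonal i j hij, smul_zero]
  · simp

theorem linearIndependent (h : S.IsPrimitiveIdempotents E) : LinearIndependent ℝ E := by
  rw [Fintype.linearIndependent_iff]
  intro c hc j
  have h1 := h.sum_smul_mul c j
  rw [hc, zero_mul] at h1
  exact (smul_eq_zero.1 h1.symm).resolve_right (h.ne_zero j)

/-- A dimension count: d + 1 independent elements lie in a space spanned by d + 1 adjacency
matrices. -/
theorem span_eq (h : S.IsPrimitiveIdempotents E) :
    Submodule.span ℝ (Set.range E) = S.boseMesner := by
  have hle : Submodule.span ℝ (Set.range E) ≤ S.boseMesner :=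
    Submodule.span_le.2 (by rintro _ ⟨i, rfl⟩; exact h.mem i)
  refine Submodule.eq_of_le_of_finrank_le hle ?_
  rw [finrank_span_eq_card h.linearIndependent]
  exact finrank_range_le_card S.adjacency

theorem exists_eq_sum (h : S.IsPrimitiveIdempotents E) {M : Matrix X X ℝ}
    (hM : M ∈ S.boseMesner) : ∃ c : Fin (d + 1) → ℝ, M = ∑ i, c i • E i := by
  rw [← h.span_eq] at hM
  obtain ⟨c, hc⟩ := (Submodule.mem_span_range_iff_exists_fun ℝ).1 hM
  exact ⟨c, hc.symm⟩

theorem exists_mul_eq (h : S.IsPrimitiveIdempotents E) {M : Matrix X X ℝ}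
    (hM : M ∈ S.boseMesner) : ∃ c : Fin (d + 1) → ℝ, ∀ j, M * E j = c j • E j := by
  obtain ⟨c, rfl⟩ := h.exists_eq_sum hM
  exact ⟨c, h.sum_smul_mul c⟩

end IsPrimitiveIdempotents

-- The degree filtration of a Q-polynomial scheme

namespace IsQPolynomial

theorem exists_entry_eq_eval (h : S.IsQPolynomial E) {M : Matrix X X ℝ} (hM : M ∈ S.boseMesner) :
    ∃ q : Polynomial ℝ, ∀ x y, M x y = q.eval ((Fintype.card X : ℝ) * E 1 x y) := by
  obtain ⟨x₀, -⟩ := S.nonempty 0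
  have hn : (Fintype.card X : ℝ) ≠ 0 := by
    have : Nonempty X := ⟨x₀⟩
    exact_mod_cast Fintype.card_ne_zero
  choose v _ hv using h.polynomial
  obtain ⟨c, rfl⟩ := h.idempotents.exists_eq_sum hM
  refine ⟨∑ i, Polynomial.C (c i / Fintype.card X) * v i, fun x y => ?_⟩
  simp only [Matrix.sum_apply, Matrix.smul_apply, smul_eq_mul, Polynomial.eval_finsetSum,
    Polynomial.eval_mul, Polynomial.eval_C, ← hv]
  refine Finset.sum_congr rfl fun i _ => ?_
  field_simp

/-- Adjacency matrices are entrywise polynomials in |X| E_1, so the entries of `E 1` separate the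
relations. This makes the embedding faithful. -/
theorem rel_eq_iff (h : S.IsQPolynomial E) (x y x' y' : X) :
    S.rel x y = S.rel x' y' ↔ E 1 x y = E 1 x' y' := by
  constructor
  · intro hr
    obtain ⟨f, hf⟩ := S.exists_eq_of_rel (h.idempotents.mem 1)
    rw [hf, hf, hr]
  · intro he
    obtain ⟨q, hq⟩ := h.exists_entry_eq_eval
      (S.of_rel_mem_boseMesner fun j => if j = S.rel x' y' then 1 else 0)
    have h1 := hq x y
    rw [he, ← hq x' y'] at h1
    by_contra hne
    simp [hne] at h1

/-- A matrix that is entrywise a polynomial of degree at most `j` in `|X| E_1` is a combination of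
`E_0, …, E_j`. -/
theorem exists_eval_eq_sum (h : S.IsQPolynomial E) (j : ℕ) :
    ∀ q : Polynomial ℝ, q.natDegree ≤ j → ∃ c : Fin (d + 1) → ℝ,
      (∀ i : Fin (d + 1), j < i → c i = 0) ∧
      (Matrix.of fun x y => q.eval ((Fintype.card X : ℝ) * E 1 x y)) = ∑ i, c i • E i := by
  obtain ⟨x₀, -⟩ := S.nonempty 0
  have hn : (Fintype.card X : ℝ) ≠ 0 := by
    have : Nonempty X := ⟨x₀⟩
    exact_mod_cast Fintype.card_ne_zero
  induction j with
  | zero =>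
    intro q hq
    obtain ⟨a, rfl⟩ : ∃ a, q = Polynomial.C a := ⟨_, Polynomial.eq_C_of_natDegree_le_zero hq⟩
    refine ⟨Pi.single 0 (a * Fintype.card X), fun i hi => ?_, ?_⟩
    · exact Pi.single_eq_of_ne (by rintro rfl; simp at hi) _
    · rw [Finset.sum_eq_single 0 (fun i _ hi => by simp [Pi.single_eq_of_ne hi]) (by simp)]
      ext x y
      simp [h.idempotents.zero_eq, hn]
  | succ j ih =>
    intro q hq
    by_cases hj : j + 1 < d + 1
    · obtain ⟨v, hv, hE⟩ := h.polynomial ⟨j + 1, hj⟩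
      have hvd : v.natDegree = j + 1 := Polynomial.natDegree_eq_of_degree_eq_some hv
      have hv0 : v.coeff (j + 1) ≠ 0 := by
        rw [← hvd]
        simpa using (fun h0 => by simp [h0] at hvd : v ≠ 0)
      -- Subtracting a multiple of the polynomial of E_{j+1} cancels the leading term of `q`; this
      -- is where the degree being exactly j + 1 matters.
      set a := q.coeff (j + 1) / v.coeff (j + 1) with ha
      obtain ⟨c, hc, hq'⟩ := ih (q - Polynomial.C a * v) (by
        refine Polynomial.natDegree_le_iff_coeff_eq_zero.2 fun N hN => ?_
        rcases Nat.lt_or_ge (j + 1) N with h1 | h1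
        · rw [Polynomial.coeff_sub, Polynomial.coeff_C_mul,
            Polynomial.coeff_eq_zero_of_natDegree_lt (by omega),
            Polynomial.coeff_eq_zero_of_natDegree_lt (by omega)]
          simp
        · obtain rfl : N = j + 1 := by omega
          rw [Polynomial.coeff_sub, Polynomial.coeff_C_mul, ha]
          field_simp
          simp)
      refine ⟨c + Pi.single ⟨j + 1, hj⟩ (a * Fintype.card X), fun i hi => ?_, ?_⟩
      · rw [Pi.add_apply, hc i (by omega), Pi.single_eq_of_ne (by rintro rfl; simp at hi), add_zero]
      · simp only [Pi.add_apply, add_smul, Finset.sum_add_distrib, ← hq']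
        rw [Finset.sum_eq_single (⟨j + 1, hj⟩ : Fin (d + 1))
          (fun i _ hi => by rw [Pi.single_eq_of_ne hi, zero_smul]) (by simp)]
        ext x y
        have := hE x y
        simp [← this, mul_assoc]
    -- Beyond degree d the vanishing condition is vacuous, so membership in the Bose–Mesner algebra
    -- suffices.
    · obtain ⟨f, hf⟩ := S.exists_eq_of_rel (h.idempotents.mem 1)
      obtain ⟨c, hc⟩ := h.idempotents.exists_eq_sum (S.of_rel_mem_boseMesner
        fun i => q.eval ((Fintype.card X : ℝ) * f i))
      refine ⟨c, fun i hi => ?_, ?_⟩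
      · have := i.2
        omega
      · rw [← hc]
        ext x y
        simp [hf]

/-- Multiplication by an element of the Bose–Mesner algebra preserves the space of the matrices that
are entrywise polynomials of degree at most `j` in `|X| E_1`. -/
theorem exists_mul_eval_eq (h : S.IsQPolynomial E) {M : Matrix X X ℝ} (hM : M ∈ S.boseMesner)
    (q : Polynomial ℝ) (j : ℕ) (hq : q.natDegree ≤ j) :
    ∃ q' : Polynomial ℝ, q'.natDegree ≤ j ∧ ∀ x y,
      (M * Matrix.of fun x y => q.eval ((Fintype.card X : ℝ) * E 1 x y)) x y =
        q'.eval ((Fintype.card X : ℝ) * E 1 x y) := by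
  obtain ⟨x₀, -⟩ := S.nonempty 0
  have hn : (Fintype.card X : ℝ) ≠ 0 := by
    have : Nonempty X := ⟨x₀⟩
    exact_mod_cast Fintype.card_ne_zero
  obtain ⟨c, hc, hqc⟩ := h.exists_eval_eq_sum j q hq
  obtain ⟨p, hp⟩ := h.idempotents.exists_mul_eq hM
  choose v hv hE using h.polynomial
  refine ⟨∑ i, Polynomial.C (c i * p i / Fintype.card X) * v i, ?_, fun x y => ?_⟩
  · refine Polynomial.natDegree_sum_le_of_forall_le _ _ fun i _ => ?_
    rcases Nat.lt_or_ge j i with h1 | h1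
    · simp [hc i h1]
    · exact (Polynomial.natDegree_C_mul_le _ _).trans
        ((Polynomial.natDegree_eq_of_degree_eq_some (hv i)).le.trans h1)
  · rw [hqc, Finset.mul_sum]
    simp only [mul_smul_comm, hp, Matrix.sum_apply, Matrix.smul_apply, smul_eq_mul,
      Polynomial.eval_finsetSum, Polynomial.eval_mul, Polynomial.eval_C, ← hE]
    refine Finset.sum_congr rfl fun i _ => ?_
    field_simp

end IsQPolynomial

end SymmetricAssociationScheme

-- Spherical models in three dimensions

/-- A symmetric association scheme on a set of unit vectors in three-dimensional Euclidean space
whose relations are given by the inner products, with the properties of the spherical embedding of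
a Q-polynomial scheme. -/
structure SymmetricAssociationScheme.IsSphericalModel {X : Type*} [Fintype X] {d : ℕ}
    (S : SymmetricAssociationScheme X d) (V : X → EuclideanSpace ℝ (Fin 3)) : Prop where
  norm_one : ∀ x, inner ℝ (V x) (V x) = 1
  rel_iff : ∀ x y x' y', S.rel x y = S.rel x' y' ↔
    inner ℝ (V x) (V y) = inner ℝ (V x') (V y')
  sum_eq_zero : ∑ x, V x = 0
  moment : ∀ u v, ∑ z, inner ℝ (V z) u * inner ℝ (V z) v =
    (Fintype.card X : ℝ) / 3 * inner ℝ u v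
  poly : ∀ (i : Fin (d + 1)) (q : Polynomial ℝ) (j : ℕ), q.natDegree ≤ j →
    ∃ q' : Polynomial ℝ, q'.natDegree ≤ j ∧ ∀ x z,
      ∑ y ∈ univ.filter (fun y => S.rel x y = i), q.eval (inner ℝ (V y) (V z)) =
        q'.eval (inner ℝ (V x) (V z))
  cubic : ∃ l : ℝ, ∀ x u, ∑ z, (inner ℝ (V x) (V z)) ^ 2 * inner ℝ (V z) u = l * inner ℝ (V x) u

theorem inner_sphericalEmbedding {X : Type*} [Fintype X] [DecidableEq X] {F : Matrix X X ℝ}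
    (hF : F * F = F) (hs : ∀ x y, F x y = F y x) (x y : X) :
    inner ℝ (sphericalEmbedding F x) (sphericalEmbedding F y) =
      (Fintype.card X : ℝ) / F.rank * F x y := by
  have h0 : (0 : ℝ) ≤ (Fintype.card X : ℝ) / F.rank := by positivity
  simp only [sphericalEmbedding, inner_smul_left, inner_smul_right, RCLike.conj_to_real,
    ← mul_assoc, Real.mul_self_sqrt h0]
  congr 1
  rw [PiLp.inner_apply]
  conv_rhs => rw [← hF]
  simp [Matrix.mul_apply, hs x]
  exact Finset.sum_congr rfl fun z _ => by ring

theorem exists_coordinates_sphericalEmbedding {X : Type*} [Fintype X] [DecidableEq X]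
    {F : Matrix X X ℝ} (h3 : F.rank = 3) :
    ∃ (V : X → EuclideanSpace ℝ (Fin 3)) (L : EuclideanSpace ℝ (Fin 3) →ₗᵢ[ℝ] EuclideanSpace ℝ X),
      ∀ x, L (V x) = sphericalEmbedding F x := by
  let W : Submodule ℝ (EuclideanSpace ℝ X) :=
    (LinearMap.range F.mulVecLin).map (WithLp.linearEquiv 2 ℝ (X → ℝ)).symm.toLinearMap
  have hW : Module.finrank ℝ W = 3 := by
    rw [← h3]
    exact LinearEquiv.finrank_eq
      ((WithLp.linearEquiv 2 ℝ (X → ℝ)).symm.submoduleMap (LinearMap.range F.mulVecLin)).symm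
  let b := (stdOrthonormalBasis ℝ W).reindex (finCongr hW)
  have hmem : ∀ x, sphericalEmbedding F x ∈ W := fun x =>
    W.smul_mem _ ⟨F.mulVec (Pi.single x 1), ⟨Pi.single x 1, rfl⟩, rfl⟩
  refine ⟨fun x => b.repr ⟨_, hmem x⟩, W.subtypeₗᵢ.comp b.repr.symm.toLinearIsometry, fun x => ?_⟩
  simp

namespace SymmetricAssociationScheme

variable {X : Type*} [Fintype X] {d : ℕ}

theorem IsQPolynomial.isSphericalModel [DecidableEq X] {S : SymmetricAssociationScheme X d}
    {E : Fin (d + 1) → Matrix X X ℝ} (h : S.IsQPolynomial E) (h3 : (E 1).rank = 3)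
    {V : X → EuclideanSpace ℝ (Fin 3)}
    (hV : ∀ x y, inner ℝ (V x) (V y) = (Fintype.card X : ℝ) / 3 * E 1 x y) :
    S.IsSphericalModel V := by
  obtain ⟨x₀, -⟩ := S.nonempty 0
  have hn : (Fintype.card X : ℝ) ≠ 0 := by
    have : Nonempty X := ⟨x₀⟩
    exact_mod_cast Fintype.card_ne_zero
  have hs := S.symm_of_mem (h.idempotents.mem 1)
  have hidem : ∀ x y, ∑ z, E 1 x z * E 1 z y = E 1 x y := fun x y => by
    conv_rhs => rw [← h.idempotents.idem 1]
    rw [Matrix.mul_apply]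
  -- For d = 0 the index 1 would wrap around to 0; but E_0 has trace 1, not 3.
  have hd : (0 : Fin (d + 1)) ≠ 1 := by
    intro h0
    have h1 := Matrix.trace_eq_rank_of_isIdempotentElem (h.idempotents.idem 1)
    rw [h3, ← h0, h.idempotents.zero_eq] at h1
    simp [Matrix.trace, hn] at h1
  have hrow : ∀ y, ∑ z, E 1 z y = 0 := fun y => by
    have h1 := congrFun (congrFun (h.idempotents.orthogonal 0 1 hd) x₀) y
    rw [Matrix.mul_apply, h.idempotents.zero_eq] at h1
    simpa [← Finset.mul_sum, hn] using h1
  have hdiag : ∀ x, E 1 x x = 3 / Fintype.card X := fun x => by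
    obtain ⟨f, hf⟩ := S.exists_eq_of_rel (h.idempotents.mem 1)
    have h1 := Matrix.trace_eq_rank_of_isIdempotentElem (h.idempotents.idem 1)
    have h0 : ∀ y, S.rel y y = 0 := fun y => (S.diag y y).2 rfl
    rw [h3] at h1
    simp only [Matrix.trace, Matrix.diag_apply, hf, h0, Finset.sum_const, Finset.card_univ,
      nsmul_eq_mul] at h1
    rw [hf, h0, eq_div_iff hn, mul_comm, h1]
    norm_num
  have hG : ∀ x y, ∑ z, inner ℝ (V x) (V z) * inner ℝ (V z) (V y) =
      (Fintype.card X : ℝ) / 3 * inner ℝ (V x) (V y) := fun x y => by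
    simp only [hV]
    rw [← hidem x y, Finset.mul_sum, Finset.mul_sum]
    exact Finset.sum_congr rfl fun z _ => by ring
  -- the vectors span the space, because their Gram matrix has rank three
  have hspan : Submodule.span ℝ (Set.range V) = ⊤ := by
    let A : Matrix X (Fin 3) ℝ := Matrix.of fun x i => V x i
    have hA : A * Aᵀ = ((Fintype.card X : ℝ) / 3) • E 1 := by
      ext x y
      rw [Matrix.smul_apply, smul_eq_mul, ← hV, PiLp.inner_apply, Matrix.mul_apply]
      exact Finset.sum_congr rfl fun i _ => by simp [A, mul_comm]
    have h1 : (A * Aᵀ).rank = 3 := by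
      rw [hA, Matrix.rank_smul_of_mem_nonZeroDivisors _ (mem_nonZeroDivisors_of_ne_zero (by positivity)), h3]
    have h2 : 3 ≤ A.rank := h1.ge.trans (Matrix.rank_mul_le_left A Aᵀ)
    rw [Matrix.rank_eq_finrank_span_row] at h2
    refine Submodule.eq_top_of_finrank_eq (le_antisymm (Submodule.finrank_le _) ?_)
    rw [finrank_euclideanSpace_fin]
    refine h2.trans (le_of_eq ?_)
    have h3 : Submodule.span ℝ (Set.range A.row) = (Submodule.span ℝ (Set.range V)).map
        (WithLp.linearEquiv 2 ℝ (Fin 3 → ℝ)).toLinearMap := by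
      rw [Submodule.map_span, ← Set.range_comp]
      rfl
    rw [h3]
    exact LinearEquiv.finrank_eq
      ((WithLp.linearEquiv 2 ℝ (Fin 3 → ℝ)).submoduleMap (Submodule.span ℝ (Set.range V))).symm
  have hext : ∀ a b : EuclideanSpace ℝ (Fin 3), (∀ x, inner ℝ (V x) a = inner ℝ (V x) b) → a = b := by
    intro a b hab
    rw [← sub_eq_zero, ← inner_self_eq_zero (𝕜 := ℝ)]
    have : ∀ w ∈ Submodule.span ℝ (Set.range V), inner ℝ w (a - b) = 0 := by
      intro w hw
      induction hw using Submodule.span_induction with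
      | mem w hw => obtain ⟨x, rfl⟩ := hw; rw [inner_sub_right, hab, sub_self]
      | zero => simp
      | add u v _ _ hu hv => rw [inner_add_left, hu, hv, add_zero]
      | smul c u _ hu => rw [inner_smul_left, hu, mul_zero]
    exact this _ (hspan ▸ Submodule.mem_top)
  have hdeg : ∀ a : ℝ, (Polynomial.C a * Polynomial.X).natDegree ≤ 1 := fun a =>
    (Polynomial.natDegree_C_mul_le _ _).trans Polynomial.natDegree_X_le
  refine ⟨fun x => ?_, fun x y x' y' => ?_, ?_, fun u v => ?_, fun i q j hq => ?_, ?_⟩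
  · rw [hV, hdiag]
    field_simp
  · rw [h.rel_eq_iff, hV, hV]
    exact (mul_right_injective₀ (by positivity : (Fintype.card X : ℝ) / 3 ≠ 0)).eq_iff.symm
  · refine hext _ _ fun x => ?_
    rw [inner_sum, inner_zero_right]
    simp_rw [hV, hs x, ← Finset.mul_sum, hrow, mul_zero]
  -- Idempotency of `E 1` gives this for u among the points, and they span.
  · have h1 : ∑ z, (inner ℝ (V z) u) • V z = ((Fintype.card X : ℝ) / 3) • u := by
      have key : ∀ w ∈ Submodule.span ℝ (Set.range V),
          ∑ z, (inner ℝ (V z) w) • V z = ((Fintype.card X : ℝ) / 3) • w := by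
        intro w hw
        induction hw using Submodule.span_induction with
        | mem w hw =>
          obtain ⟨y, rfl⟩ := hw
          refine hext _ _ fun x => ?_
          rw [inner_sum, inner_smul_right, ← hG]
          exact Finset.sum_congr rfl fun z _ => by rw [inner_smul_right, mul_comm]
        | zero => simp
        | add a b _ _ ha hb => simp only [inner_add_right, add_smul, Finset.sum_add_distrib, ha, hb,
            smul_add]
        | smul c a _ ha =>
          simp only [inner_smul_right, mul_smul, ← Finset.smul_sum, ha]
          rw [smul_comm]
      exact key u (hspan ▸ Submodule.mem_top)
    have h2 := congrArg (fun w => inner ℝ w v) h1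
    simpa [sum_inner, inner_smul_left] using h2
  · obtain ⟨q', hq', he⟩ := h.exists_mul_eval_eq
      (Submodule.subset_span (Set.mem_range_self i) : S.adjacency i ∈ S.boseMesner)
      (q.comp (Polynomial.C (1 / 3) * Polynomial.X)) j (by
        rw [Polynomial.natDegree_comp]
        exact (Nat.mul_le_mul_left _ (hdeg _)).trans (by omega))
    refine ⟨q'.comp (Polynomial.C 3 * Polynomial.X), ?_, fun x z => ?_⟩
    · rw [Polynomial.natDegree_comp]
      exact (Nat.mul_le_mul_left _ (hdeg _)).trans (by omega)
    · have h1 := he x z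
      rw [adjacency_mul_apply] at h1
      simp only [Matrix.of_apply, Polynomial.eval_comp, Polynomial.eval_mul, Polynomial.eval_C,
        Polynomial.eval_X] at h1 ⊢
      rw [hV x z, mul_left_comm, ← mul_assoc, div_mul_cancel₀ _ (by norm_num : (3 : ℝ) ≠ 0), ← h1]
      refine Finset.sum_congr rfl fun y _ => ?_
      rw [hV]
      congr 1
      ring
  · obtain ⟨f, hf⟩ := S.exists_eq_of_rel (h.idempotents.mem 1)
    obtain ⟨c, hc⟩ := h.idempotents.exists_mul_eq
      (S.of_rel_mem_boseMesner fun i => ((Fintype.card X : ℝ) / 3 * f i) ^ 2)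
    -- The entrywise square of the Gram matrix lies in the Bose–Mesner algebra; its eigenvalue on `E
    -- 1` is the constant, a multiple of the Krein parameter q_{11}^1.
    refine ⟨c 1, fun x u => ?_⟩
    have h1 : ∑ z, (inner ℝ (V x) (V z)) ^ 2 • V z = c 1 • V x := by
      refine hext _ _ fun y => ?_
      rw [inner_sum, inner_smul_right]
      have h2 := congrFun (congrFun (hc 1) x) y
      rw [Matrix.mul_apply, Matrix.smul_apply, smul_eq_mul] at h2
      simp only [Matrix.of_apply, ← hf, ← hV] at h2
      rw [hV y x, hs y x, mul_left_comm, ← h2, Finset.mul_sum]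
      refine Finset.sum_congr rfl fun z _ => ?_
      rw [inner_smul_right, hV y z, hs y z]
      ring
    have h2 := congrArg (fun w => inner ℝ w u) h1
    simpa [sum_inner, inner_smul_left] using h2

namespace IsSphericalModel

variable {S : SymmetricAssociationScheme X d} {V : X → EuclideanSpace ℝ (Fin 3)}

theorem ext_inner (h : S.IsSphericalModel V) {a b : EuclideanSpace ℝ (Fin 3)}
    (hab : ∀ x, inner ℝ (V x) a = inner ℝ (V x) b) : a = b := by
  obtain ⟨x₀, -⟩ := S.nonempty 0
  have hn : (Fintype.card X : ℝ) ≠ 0 := by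
    have : Nonempty X := ⟨x₀⟩
    exact_mod_cast Fintype.card_ne_zero
  have h1 := h.moment (a - b) (a - b)
  simp only [inner_sub_right (V _), hab, sub_self, mul_zero, Finset.sum_const_zero] at h1
  rw [← sub_eq_zero, ← inner_self_eq_zero (𝕜 := ℝ)]
  exact (mul_eq_zero.1 h1.symm).resolve_left (by positivity)

theorem injective (h : S.IsSphericalModel V) : Function.Injective V := fun x y hxy => by
  rw [← S.diag, ← (S.diag x x).2 rfl, h.rel_iff, hxy]

theorem inner_eq_one_iff (h : S.IsSphericalModel V) {x y : X} :
    inner ℝ (V x) (V y) = 1 ↔ x = y := by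
  rw [← S.diag, ← (S.diag x x).2 rfl, h.rel_iff, h.norm_one]

theorem sum_inner_eq_zero (h : S.IsSphericalModel V) (u : EuclideanSpace ℝ (Fin 3)) :
    ∑ z, inner ℝ (V z) u = 0 := by
  rw [← sum_inner, h.sum_eq_zero, inner_zero_left]

end IsSphericalModel

end SymmetricAssociationScheme

end

-- Euclidean geometry: pairs of unit vectors and regular polygons

section

open Finset

local notation "𝔼" => EuclideanSpace ℝ (Fin 3)

namespace EuclideanSpace

theorem real_inner_fin_three (x y : 𝔼) : inner ℝ x y = x 0 * y 0 + x 1 * y 1 + x 2 * y 2 := by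
  simp [PiLp.inner_apply, Fin.sum_univ_three]
  ring

/-- Two unit vectors that are not parallel are in the span of the first two vectors of an
orthonormal basis. -/
theorem exists_orthonormalBasis_of_unit {x y : 𝔼} {t : ℝ} (hx : inner ℝ x x = (1 : ℝ))
    (hy : inner ℝ y y = (1 : ℝ)) (hxy : inner ℝ x y = t) (ht : t ^ 2 < 1) :
    ∃ b : OrthonormalBasis (Fin 3) ℝ 𝔼, b 0 = x ∧ y = t • x + √(1 - t ^ 2) • b 1 := by
  have hs : 0 < √(1 - t ^ 2) := Real.sqrt_pos.2 (by linarith)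
  have hs2 : √(1 - t ^ 2) ^ 2 = 1 - t ^ 2 := Real.sq_sqrt (by linarith)
  have hyx : inner ℝ y x = t := by rw [real_inner_comm, hxy]
  set s := √(1 - t ^ 2)
  let v : Fin 3 → 𝔼 := ![x, s⁻¹ • (y - t • x), 0]
  have hv : Orthonormal ℝ (({0, 1} : Set (Fin 3)).domRestrict v) := by
    have h1 : inner ℝ (s⁻¹ • (y - t • x)) (s⁻¹ • (y - t • x)) = (1 : ℝ) := by
      simp only [inner_smul_left, inner_smul_right, inner_sub_left, inner_sub_right, hx, hy, hxy,
        hyx, RCLike.conj_to_real]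
      field_simp
      linarith
    have h2 : inner ℝ x (s⁻¹ • (y - t • x)) = (0 : ℝ) := by
      rw [inner_smul_right, inner_sub_right, inner_smul_right, hx, hxy, mul_one, sub_self, mul_zero]
    rw [orthonormal_iff_ite]
    rintro ⟨i, hi⟩ ⟨j, hj⟩
    rcases hi with rfl | rfl <;> rcases hj with rfl | rfl
    · exact hx
    · exact h2
    · exact (real_inner_comm _ _).trans h2
    · exact h1
  obtain ⟨b, hb⟩ := hv.exists_orthonormalBasis_extension_of_card_eq (by simp)
  refine ⟨b, hb 0 (by simp), ?_⟩
  rw [hb 1 (by simp)]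
  simp [v, smul_smul, hs.ne']

/-- Two pairs of unit vectors with the same inner product are congruent. -/
theorem exists_linearIsometryEquiv_of_inner_eq {x y x' y' : 𝔼} {t : ℝ}
    (hx : inner ℝ x x = (1 : ℝ)) (hy : inner ℝ y y = (1 : ℝ)) (hxy : inner ℝ x y = t)
    (hx' : inner ℝ x' x' = (1 : ℝ)) (hy' : inner ℝ y' y' = (1 : ℝ)) (hxy' : inner ℝ x' y' = t)
    (ht : t ^ 2 < 1) : ∃ R : 𝔼 ≃ₗᵢ[ℝ] 𝔼, R x = x' ∧ R y = y' := by
  obtain ⟨b, rfl, hb⟩ := exists_orthonormalBasis_of_unit hx hy hxy ht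
  obtain ⟨b', rfl, hb'⟩ := exists_orthonormalBasis_of_unit hx' hy' hxy' ht
  have h : ∀ i, b.equiv b' (Equiv.refl _) (b i) = b' i := fun i => by simp
  exact ⟨b.equiv b' (Equiv.refl _), h 0, by rw [hb, hb', map_add, map_smul, map_smul, h, h]⟩

/-- A line meets the unit sphere in at most two points. -/
theorem eq_or_eq_of_inner_eq {x y z z₁ z₂ : 𝔼} {t α β : ℝ}
    (hx : inner ℝ x x = (1 : ℝ)) (hy : inner ℝ y y = (1 : ℝ)) (hxy : inner ℝ x y = t)
    (ht : t ^ 2 < 1) (hz : inner ℝ z z = (1 : ℝ)) (h₁ : inner ℝ z₁ z₁ = (1 : ℝ))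
    (h₂ : inner ℝ z₂ z₂ = (1 : ℝ)) (hzx : inner ℝ x z = α) (hzx₁ : inner ℝ x z₁ = α)
    (hzx₂ : inner ℝ x z₂ = α) (hzy : inner ℝ y z = β) (hzy₁ : inner ℝ y z₁ = β)
    (hzy₂ : inner ℝ y z₂ = β) (hne : z₁ ≠ z₂) : z = z₁ ∨ z = z₂ := by
  obtain ⟨b, rfl, hb⟩ := exists_orthonormalBasis_of_unit hx hy hxy ht
  have hs : 0 < √(1 - t ^ 2) := Real.sqrt_pos.2 (by linarith)
  set s := √(1 - t ^ 2)
  have h0 : ∀ w, inner ℝ y w = t * inner ℝ (b 0) w + s * inner ℝ (b 1) w := fun w => by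
    rw [hb, inner_add_left, inner_smul_left, inner_smul_left]
    simp
  have h1 : ∀ w : 𝔼, inner ℝ w w = inner ℝ (b 0) w ^ 2 + inner ℝ (b 1) w ^ 2 + inner ℝ (b 2) w ^ 2 :=
    fun w => by
      rw [← b.sum_inner_mul_inner w w, Fin.sum_univ_three]
      simp only [real_inner_comm]
      ring
  have hext : ∀ v w : 𝔼, inner ℝ (b 0) v = α → inner ℝ y v = β → inner ℝ (b 0) w = α →
      inner ℝ y w = β → inner ℝ (b 2) v = inner ℝ (b 2) w → v = w := by
    intro v w hv0 hv1 hw0 hw1 h2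
    rw [h0, hv0] at hv1
    rw [h0, hw0] at hw1
    refine b.repr.injective (PiLp.ext fun i => ?_)
    rw [b.repr_apply_apply, b.repr_apply_apply]
    fin_cases i
    · simpa using hv0.trans hw0.symm
    · simpa using mul_left_cancel₀ hs.ne' (by linarith : s * inner ℝ (b 1) v = s * inner ℝ (b 1) w)
    · simpa using h2
  have hq : ∀ v w : 𝔼, inner ℝ v v = (1 : ℝ) → inner ℝ w w = (1 : ℝ) →
      inner ℝ (b 0) v = α → inner ℝ y v = β → inner ℝ (b 0) w = α →
      inner ℝ y w = β → v = w ∨ inner ℝ (b 2) v = - inner ℝ (b 2) w := by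
    intro v w hv hw hv0 hv1 hw0 hw1
    have hvw : inner ℝ (b 1) v = inner ℝ (b 1) w := by
      have e1 := h0 v
      have e2 := h0 w
      rw [hv0, hv1] at e1
      rw [hw0, hw1] at e2
      exact mul_left_cancel₀ hs.ne' (by linarith)
    have : inner ℝ (b 2) v ^ 2 = inner ℝ (b 2) w ^ 2 := by
      have e1 := h1 v
      have e2 := h1 w
      rw [hv, hv0, hvw] at e1
      rw [hw, hw0] at e2
      linarith
    rcases sq_eq_sq_iff_eq_or_eq_neg.1 this with e | e
    · exact Or.inl (hext v w hv0 hv1 hw0 hw1 e)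
    · exact Or.inr e
  rcases hq z z₁ hz h₁ hzx hzy hzx₁ hzy₁ with e | e
  · exact Or.inl e
  · rcases hq z₁ z₂ h₁ h₂ hzx₁ hzy₁ hzx₂ hzy₂ with e' | e'
    · exact absurd e' hne
    · exact Or.inr (hext _ _ hzx hzy hzx₂ hzy₂ (by linarith))

/-- The vertices of a regular polygon of radius `r` and angle `θ` at height `h`. -/
noncomputable def polygon (r h θ : ℝ) (j : ℕ) : 𝔼 :=
  !₂[r * Real.cos (j * θ), r * Real.sin (j * θ), h]

theorem inner_polygon (r h θ : ℝ) (i j : ℕ) :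
    inner ℝ (polygon r h θ i) (polygon r h θ j) =
      r ^ 2 * Real.cos ((j : ℝ) * θ - i * θ) + h ^ 2 := by
  rw [real_inner_fin_three, Real.cos_sub]
  simp [polygon]
  ring

theorem inner_polygon_succ (r h θ : ℝ) (j : ℕ) :
    inner ℝ (polygon r h θ j) (polygon r h θ (j + 1)) = r ^ 2 * Real.cos θ + h ^ 2 := by
  rw [inner_polygon]
  congr 3
  push_cast
  ring

theorem inner_polygon_succ_succ (r h θ : ℝ) (j : ℕ) :
    inner ℝ (polygon r h θ j) (polygon r h θ (j + 2)) = r ^ 2 * Real.cos (2 * θ) + h ^ 2 := by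
  rw [inner_polygon]
  congr 3
  push_cast
  ring

theorem inner_polygon_self (r h θ : ℝ) (j : ℕ) :
    inner ℝ (polygon r h θ j) (polygon r h θ j) = r ^ 2 + h ^ 2 := by
  rw [inner_polygon]
  simp

end EuclideanSpace

-- Regularity of faces and vertex figures

/-- The cosine of the angle of a regular polygon with three, four or five vertices, characterized by
the fact that no step of the rotation is shorter than the first one. -/
theorem cos_eq_of_forall_cos_mul_le {θ : ℝ} (h₀ : -1 / 2 ≤ Real.cos θ) (h₁ : Real.cos θ < 1 / 2)
    (h : ∀ j : ℕ, Real.cos (j * θ) = 1 ∨ Real.cos (j * θ) ≤ Real.cos θ) :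
    Real.cos θ = -1 / 2 ∨ Real.cos θ = 0 ∨ Real.cos θ = (√5 - 1) / 4 := by
  have h2 := Real.cos_two_mul θ
  have h3 := Real.cos_three_mul θ
  have h5 : Real.cos (5 * θ) = 16 * Real.cos θ ^ 5 - 20 * Real.cos θ ^ 3 + 5 * Real.cos θ := by
    have e1 : Real.cos (5 * θ) + Real.cos θ = 2 * Real.cos (3 * θ) * Real.cos (2 * θ) := by
      rw [show 5 * θ = 3 * θ + 2 * θ by ring, Real.cos_add,
        show Real.cos θ = Real.cos (3 * θ - 2 * θ) by congr 1; ring, Real.cos_sub]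
      ring
    rw [h2, h3] at e1
    linear_combination e1
  -- Two multiples suffice. For -1/2 < c < 0 one has cos 3θ > c and cos 3θ ≠ 1, which is impossible;
  -- for 0 < c < 1/2 one has cos 5θ > c, so cos 5θ = 1 and 4c² + 2c - 1 = 0.
  have g3 := h 3
  have g5 := h 5
  push_cast at g3 g5
  rw [h3] at g3
  rw [h5] at g5
  generalize Real.cos θ = c at *
  have hc : ∀ c' : ℝ, -1 / 2 < c' → c' < 1 / 2 → 4 * c' ^ 2 + 2 * c' - 1 = 0 → c' = (√5 - 1) / 4 := by
    intro c' _ _ h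
    have : √5 = 4 * c' + 1 := by
      rw [Real.sqrt_eq_iff_mul_self_eq (by norm_num) (by nlinarith)]
      linarith
    linarith
  rcases eq_or_lt_of_le h₀ with e | h₀
  · exact Or.inl e.symm
  have c0 : 0 ≤ c := by
    rcases g3 with g | g
    · have : (c - 1) * (2 * c + 1) ^ 2 = 0 := by linear_combination g
      rcases mul_eq_zero.1 this with e | e
      · linarith
      · have := pow_eq_zero_iff (two_ne_zero) |>.1 e
        linarith
    · by_contra hneg
      push Not at hneg
      nlinarith [mul_pos_of_neg_of_neg hneg (by nlinarith : c ^ 2 - 1 < 0)]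
  rcases eq_or_lt_of_le c0 with e | c0
  · exact Or.inr (Or.inl e.symm)
  refine Or.inr (Or.inr (hc c h₀ h₁ ?_))
  rcases g5 with g | g
  · have : (c - 1) * (4 * c ^ 2 + 2 * c - 1) ^ 2 = 0 := by linear_combination g
    rcases mul_eq_zero.1 this with e | e
    · linarith
    · exact pow_eq_zero_iff (two_ne_zero) |>.1 e
  · exfalso
    have e1 : 0 < 1 - c ^ 2 := by nlinarith
    have e2 : 0 < 1 - 4 * c ^ 2 := by nlinarith
    have e3 := mul_pos (mul_pos c0 e1) e2
    nlinarith

/-- A set of points of the unit sphere with largest inner product `t`, in which the two points that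
complete a pair of nearest points `x`, `y` to an angle with vertex `x` of a certain size (the size
being given by the inner product `s` of the end points) always belong to the set. -/
structure IsNearestClosed (Y : Set 𝔼) (t s : ℝ) : Prop where
  unit : ∀ y ∈ Y, inner ℝ y y = (1 : ℝ)
  le : ∀ x ∈ Y, ∀ y ∈ Y, x ≠ y → inner ℝ x y ≤ t
  attained : ∃ x ∈ Y, ∃ y ∈ Y, inner ℝ x y = t
  closed : ∀ x ∈ Y, ∀ y ∈ Y, inner ℝ x y = t → ∀ z, inner ℝ z z = (1 : ℝ) → inner ℝ x z = t →
    inner ℝ y z = s → z ∈ Y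

namespace IsNearestClosed

open EuclideanSpace

variable {Y : Set 𝔼} {t s : ℝ}

theorem preimage (h : IsNearestClosed Y t s) (R : 𝔼 ≃ₗᵢ[ℝ] 𝔼) :
    IsNearestClosed (R ⁻¹' Y) t s where
  unit y hy := by rw [← R.inner_map_map, h.unit _ hy]
  le x hx y hy hxy := by
    rw [← R.inner_map_map]
    exact h.le _ hx _ hy (R.injective.ne hxy)
  attained := by
    obtain ⟨x, hx, y, hy, hxy⟩ := h.attained
    refine ⟨R.symm x, by simpa using hx, R.symm y, by simpa using hy, ?_⟩
    rw [R.symm.inner_map_map, hxy]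
  closed x hx y hy hxy z hz hxz hyz :=
    h.closed _ hx _ hy (by rw [R.inner_map_map, hxy]) _ (by rw [R.inner_map_map, hz])
      (by rw [R.inner_map_map, hxz]) (by rw [R.inner_map_map, hyz])

/-- The pair of nearest points may be moved to a given position. -/
theorem exists_preimage_mem (h : IsNearestClosed Y t s) (ht : t ^ 2 < 1) {a b : 𝔼}
    (ha : inner ℝ a a = (1 : ℝ)) (hb : inner ℝ b b = (1 : ℝ)) (hab : inner ℝ a b = t) :
    ∃ R : 𝔼 ≃ₗᵢ[ℝ] 𝔼, a ∈ R ⁻¹' Y ∧ b ∈ R ⁻¹' Y ∧ IsNearestClosed (R ⁻¹' Y) t s := by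
  obtain ⟨x, hx, y, hy, hxy⟩ := h.attained
  obtain ⟨R, h1, h2⟩ := exists_linearIsometryEquiv_of_inner_eq ha hb hab (h.unit x hx)
    (h.unit y hy) hxy ht
  exact ⟨R, by simpa [h1] using hx, by simpa [h2] using hy, h.preimage R⟩

/-- The faces are regular polygons, hence there are three possibilities for their angle. -/
theorem cos_face (h : IsNearestClosed Y t s) (ht : t ^ 2 < 1) {c : ℝ}
    (hc₀ : -1 / 2 ≤ c) (hc₁ : c < 1 / 2) (hct : c ≤ t)
    (hs : 1 - s = 2 * (1 + c) * (1 - t)) :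
    c = -1 / 2 ∨ c = 0 ∨ c = (√5 - 1) / 4 := by
  have ht' := abs_lt.1 ((sq_lt_one_iff_abs_lt_one t).1 ht)
  obtain ⟨θ, rfl⟩ : ∃ θ, Real.cos θ = c :=
    ⟨Real.arccos c, Real.cos_arccos (by linarith) (by linarith)⟩
  have hB : 0 < (1 - t) / (1 - Real.cos θ) := div_pos (by linarith) (by linarith)
  refine cos_eq_of_forall_cos_mul_le hc₀ hc₁ fun j => ?_
  have hB1 : (1 - t) / (1 - Real.cos θ) ≤ 1 := by
    rw [div_le_one (by linarith)]
    linarith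
  -- Radius and height of the polygon on the unit sphere whose sides have inner product t; the
  -- height is real because cos θ ≤ t. By `hs`, its short diagonals then have inner product s.
  set r := √((1 - t) / (1 - Real.cos θ)) with hr
  set a := √(1 - (1 - t) / (1 - Real.cos θ)) with ha
  have hr2 : r ^ 2 = (1 - t) / (1 - Real.cos θ) := Real.sq_sqrt hB.le
  have ha2 : a ^ 2 = 1 - (1 - t) / (1 - Real.cos θ) := Real.sq_sqrt (by linarith)
  have e1 : r ^ 2 + a ^ 2 = 1 := by rw [hr2, ha2]; ring
  have e2 : r ^ 2 * Real.cos θ + a ^ 2 = t := by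
    rw [hr2, ha2]
    field_simp [(by linarith : 1 - Real.cos θ ≠ 0)]
    ring
  have e3 : r ^ 2 * Real.cos (2 * θ) + a ^ 2 = s := by
    rw [Real.cos_two_mul]
    linear_combination (-2 * Real.cos θ - 1) * e1 + (2 + 2 * Real.cos θ) * e2 + hs
  obtain ⟨R, h0, h1, hR⟩ := h.exists_preimage_mem ht
    ((inner_polygon_self r a θ 0).trans e1) ((inner_polygon_self r a θ 1).trans e1)
    ((inner_polygon_succ r a θ 0).trans e2)
  have hmem : ∀ j, polygon r a θ j ∈ R ⁻¹' Y ∧ polygon r a θ (j + 1) ∈ R ⁻¹' Y := by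
    intro j
    induction j with
    | zero => exact ⟨h0, h1⟩
    | succ j ih =>
      refine ⟨ih.2, hR.closed _ ih.2 _ ih.1 ?_ _ ?_ ?_ ?_⟩
      · rw [real_inner_comm, inner_polygon_succ, e2]
      · rw [inner_polygon_self, e1]
      · rw [inner_polygon_succ, e2]
      · rw [inner_polygon_succ_succ, e3]
  by_cases hj : polygon r a θ 0 = polygon r a θ j
  · left
    have h2 := inner_polygon r a θ 0 j
    rw [← hj, inner_polygon_self] at h2
    simp only [Nat.cast_zero, zero_mul, sub_zero, add_left_inj] at h2
    have : 0 < r ^ 2 := hr2 ▸ hB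
    nlinarith
  · right
    have h2 := hR.le _ h0 _ (hmem j).1 hj
    rw [inner_polygon] at h2
    simp only [Nat.cast_zero, zero_mul, sub_zero] at h2
    have : 0 < r ^ 2 := hr2 ▸ hB
    nlinarith

/-- The vertex figures are regular polygons, hence there are three possibilities for their angle. -/
theorem cos_vertexFigure (h : IsNearestClosed Y t s) (ht : t ^ 2 < 1) {c : ℝ}
    (hc₀ : -1 / 2 ≤ c) (hc₁ : c < 1 / 2) (hs : s = (1 - t ^ 2) * c + t ^ 2)
    (hle : ∀ x ∈ Y, ∀ y ∈ Y, ∀ z ∈ Y, inner ℝ x y = t → inner ℝ x z = t → y ≠ z →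
      inner ℝ y z ≤ s) :
    c = -1 / 2 ∨ c = 0 ∨ c = (√5 - 1) / 4 := by
  obtain ⟨θ, rfl⟩ : ∃ θ, Real.cos θ = c :=
    ⟨Real.arccos c, Real.cos_arccos (by linarith) (by linarith)⟩
  refine cos_eq_of_forall_cos_mul_le hc₀ hc₁ fun j => ?_
  -- The neighbours of the pole at inner product t lie on the circle of this radius at height t.
  set r := √(1 - t ^ 2) with hr
  have hr2 : r ^ 2 = 1 - t ^ 2 := Real.sq_sqrt (by linarith)
  have e1 : r ^ 2 + t ^ 2 = 1 := by rw [hr2]; ring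
  have e2 : r ^ 2 * Real.cos θ + t ^ 2 = s := by rw [hr2, hs]
  let e : 𝔼 := !₂[0, 0, 1]
  have he : inner ℝ e e = (1 : ℝ) := by rw [real_inner_fin_three]; simp [e]
  have hep : ∀ j, inner ℝ e (polygon r t θ j) = t := by simp [real_inner_fin_three, e, polygon]
  obtain ⟨R, hx, h0, hR⟩ := h.exists_preimage_mem ht he
    ((inner_polygon_self r t θ 0).trans e1) (hep 0)
  have hmem : ∀ j, polygon r t θ j ∈ R ⁻¹' Y := by
    intro j
    induction j with
    | zero => exact h0
    | succ j ih =>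
      refine hR.closed _ hx _ ih (hep j) _ ?_ (hep _) ?_
      · rw [inner_polygon_self, e1]
      · rw [inner_polygon_succ, e2]
  have hr0 : 0 < r ^ 2 := by linarith
  by_cases hj : polygon r t θ 0 = polygon r t θ j
  · left
    have h2 := inner_polygon r t θ 0 j
    rw [← hj, inner_polygon_self] at h2
    simp only [Nat.cast_zero, zero_mul, sub_zero, add_left_inj] at h2
    nlinarith
  · right
    have h2 := hle _ hx _ h0 _ (hmem j) (by rw [R.inner_map_map, hep])
      (by rw [R.inner_map_map, hep]) (R.injective.ne hj)
    rw [R.inner_map_map, inner_polygon, ← e2] at h2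
    simp only [Nat.cast_zero, zero_mul, sub_zero] at h2
    nlinarith

/-- The vertex-figure cosine C and the face cosine both lie in {-1/2, 0, (√5-1)/4}, and together
they determine t and s. Of the nine combinations, t < 1 leaves the five regular polyhedra. -/
theorem cases (h : IsNearestClosed Y t s) (ht : t ^ 2 < 1) (hst : s ≤ t)
    (hs : t ^ 2 - (1 - t ^ 2) / 2 ≤ s)
    (hle : ∀ x ∈ Y, ∀ y ∈ Y, ∀ z ∈ Y, inner ℝ x y = t → inner ℝ x z = t → y ≠ z →
      inner ℝ y z ≤ s) :
    t = -1 / 3 ∧ s = -1 / 3 ∨ t = 0 ∧ s = 0 ∨ t = 1 / 3 ∧ s = -1 / 3 ∨ t = √5 / 3 ∧ s = 1 / 3 ∨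
      t = √5 / 5 ∧ s = √5 / 5 := by
  have h5 : √5 ^ 2 = 5 := Real.sq_sqrt (by norm_num)
  have h50 : 0 ≤ √5 := Real.sqrt_nonneg _
  obtain ⟨h1, h2⟩ := abs_lt.1 ((sq_lt_one_iff_abs_lt_one t).1 ht)
  have ht' : 0 < 1 - t ^ 2 := by linarith
  obtain ⟨C, hC⟩ : ∃ C, s = (1 - t ^ 2) * C + t ^ 2 :=
    ⟨(s - t ^ 2) / (1 - t ^ 2), by field_simp; ring⟩
  have hC0 : -1 / 2 ≤ C := by nlinarith
  have hCt : (1 + t) * C ≤ t := by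
    by_contra hcon
    push Not at hcon
    nlinarith [mul_lt_mul_of_pos_left hcon (by linarith : 0 < 1 - t)]
  have hC1 : C < 1 / 2 := by
    by_contra hcon
    push Not at hcon
    nlinarith
  -- Obtained by solving 1 - s = 2(1 + c)(1 - t) with 1 - s = (1 - t²)(1 - C). The bound c ≥ -1/2
  -- amounts to s ≤ t.
  have hc := h.cos_face ht (c := (1 + t) * (1 - C) / 2 - 1) (by nlinarith) (by nlinarith)
    (by nlinarith) (by rw [hC]; ring)
  have hC' := h.cos_vertexFigure ht hC0 hC1 hC hle
  rcases hC' with rfl | rfl | rfl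
  · rcases hc with e | e | e
    · obtain rfl : t = -1 / 3 := by linarith
      exact Or.inl ⟨rfl, by rw [hC]; norm_num⟩
    · obtain rfl : t = 1 / 3 := by linarith
      exact Or.inr (Or.inr (Or.inl ⟨rfl, by rw [hC]; norm_num⟩))
    · obtain rfl : t = √5 / 3 := by linarith
      exact Or.inr (Or.inr (Or.inr (Or.inl ⟨rfl, by rw [hC]; linear_combination h5 / 6⟩)))
  · rcases hc with e | e | e
    · obtain rfl : t = 0 := by linarith
      exact Or.inr (Or.inl ⟨rfl, by rw [hC]; norm_num⟩)
    · linarith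
    · nlinarith
  · have h51 : 1 < √5 := by nlinarith
    rcases hc with e | e | e
    · have : t = √5 / 5 := by nlinarith
      refine Or.inr (Or.inr (Or.inr (Or.inr ⟨this, ?_⟩)))
      rw [hC, this]
      linear_combination (1 / 20 - √5 / 100) * h5
    · nlinarith
    · nlinarith

end IsNearestClosed

-- Recognition of a polyhedron from one edge

section

open EuclideanSpace

theorem mem_cyclicSigned_iff {a b c : ℝ} {v : 𝔼} : v ∈ cyclicSigned a b c ↔
    ∃ p q r : ℝ, (p = 1 ∨ p = -1) ∧ (q = 1 ∨ q = -1) ∧ (r = 1 ∨ r = -1) ∧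
      (v = !₂[p * a, q * b, r * c] ∨ v = !₂[p * b, q * c, r * a] ∨ v = !₂[p * c, q * a, r * b]) := by
  have hu : ∀ p : ℝ, p = 1 ∨ p = -1 → ∃ u : ℤˣ, ((u : ℤ) : ℝ) = p := by
    rintro p (rfl | rfl)
    · exact ⟨1, by simp⟩
    · exact ⟨-1, by simp⟩
  constructor
  · rintro ⟨k, ε, h⟩
    have hε : ∀ i, ((ε i : ℤ) : ℝ) = 1 ∨ ((ε i : ℤ) : ℝ) = -1 := fun i => by
      rcases Int.units_eq_one_or (ε i) with e | e <;> simp [e]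
    refine ⟨_, _, _, hε 0, hε 1, hε 2, ?_⟩
    fin_cases k
    · left
      ext i
      fin_cases i <;> simp [h]
    · right; left
      ext i
      fin_cases i <;> simp [h]
    · right; right
      ext i
      fin_cases i <;> simp [h]
  · rintro ⟨p, q, r, hp, hq, hr, h⟩
    obtain ⟨p, rfl⟩ := hu p hp
    obtain ⟨q, rfl⟩ := hu q hq
    obtain ⟨r, rfl⟩ := hu r hr
    rcases h with rfl | rfl | rfl
    · exact ⟨0, ![p, q, r], fun i => by fin_cases i <;> simp⟩
    · exact ⟨1, ![p, q, r], fun i => by fin_cases i <;> simp⟩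
    · exact ⟨2, ![p, q, r], fun i => by fin_cases i <;> simp⟩

theorem inner_mk_mk (a b c a' b' c' : ℝ) :
    inner ℝ (!₂[a, b, c] : 𝔼) !₂[a', b', c'] = a * a' + b * b' + c * c' := by
  rw [real_inner_fin_three]
  rfl

theorem inner_smul_sqrt_inv {N : ℝ} (hN : 0 < N) (x y : 𝔼) :
    inner ℝ ((√N)⁻¹ • x) ((√N)⁻¹ • y) = inner ℝ x y / N := by
  rw [inner_smul_left, inner_smul_right, RCLike.conj_to_real, ← mul_assoc, ← mul_inv,
    Real.mul_self_sqrt hN.le]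
  field_simp

/-- The pair of nearest points may be moved to a given position on a sphere of radius `√N`. -/
theorem IsNearestClosed.exists_scaled_preimage_mem {Y : Set 𝔼} {t s : ℝ}
    (h : IsNearestClosed Y t s) (ht : t ^ 2 < 1) {N : ℝ} (hN : 0 < N) {a b : 𝔼}
    (ha : inner ℝ a a = N) (hb : inner ℝ b b = N) (hab : inner ℝ a b = N * t) :
    ∃ R : 𝔼 ≃ₗᵢ[ℝ] 𝔼, IsNearestClosed (R ⁻¹' Y) t s ∧ R ((√N)⁻¹ • a) ∈ Y ∧
      R ((√N)⁻¹ • b) ∈ Y ∧ ∀ x ∈ {v | R ((√N)⁻¹ • v) ∈ Y}, ∀ y ∈ {v | R ((√N)⁻¹ • v) ∈ Y},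
        inner ℝ x y = N * t → ∀ z, inner ℝ z z = N → inner ℝ x z = N * t →
          inner ℝ y z = N * s → z ∈ {v | R ((√N)⁻¹ • v) ∈ Y} := by
  have hi := inner_smul_sqrt_inv hN
  obtain ⟨R, haR, hbR, hR⟩ := h.exists_preimage_mem ht (a := (√N)⁻¹ • a) (b := (√N)⁻¹ • b)
    (by rw [hi, ha, div_self hN.ne']) (by rw [hi, hb, div_self hN.ne'])
    (by rw [hi, hab, mul_div_cancel_left₀ _ hN.ne'])
  exact ⟨R, hR, haR, hbR, fun x hx y hy hxy z hz hxz hyz =>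
    hR.closed _ hx _ hy (by rw [hi, hxy, mul_div_cancel_left₀ _ hN.ne']) _
      (by rw [hi, hz, div_self hN.ne']) (by rw [hi, hxz, mul_div_cancel_left₀ _ hN.ne'])
      (by rw [hi, hyz, mul_div_cancel_left₀ _ hN.ne'])⟩

/-- A set of unit vectors that is closed under completing angles between nearest points is
congruent to a polyhedron, if it contains an edge of the polyhedron, the edge generates the vertices
of the polyhedron and the caps around these vertices cover the sphere. -/
theorem IsNearestClosed.exists_image_vertices_eq {Y : Set 𝔼} {t s : ℝ} (h : IsNearestClosed Y t s)
    (ht : t ^ 2 < 1) (P : SchemePolyhedron) {N : ℝ} (hN : 0 < N)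
    (hnorm : ∀ v ∈ P.rawVertices, inner ℝ v v = N) {a b : 𝔼} (ha : inner ℝ a a = N)
    (hb : inner ℝ b b = N) (hab : inner ℝ a b = N * t)
    (hcov : ∀ z : 𝔼, inner ℝ z z = (1 : ℝ) → ¬ ∀ v ∈ P.rawVertices, inner ℝ z v ≤ t * √N)
    (hgen : ∀ Y' : Set 𝔼, a ∈ Y' → b ∈ Y' → (∀ x ∈ Y', ∀ y ∈ Y', inner ℝ x y = N * t →
      ∀ z, inner ℝ z z = N → inner ℝ x z = N * t → inner ℝ y z = N * s → z ∈ Y') →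
      P.rawVertices ⊆ Y') :
    ∃ R : 𝔼 ≃ₗᵢ[ℝ] 𝔼, R '' P.vertices = Y := by
  have hq : 0 < √N := Real.sqrt_pos.2 hN
  obtain ⟨R, hR, haR, hbR, hcl⟩ := h.exists_scaled_preimage_mem ht hN ha hb hab
  have hsub : ∀ v ∈ P.rawVertices, (√N)⁻¹ • v ∈ R ⁻¹' Y := hgen _ haR hbR hcl
  have hv : ∀ v ∈ P.rawVertices, ‖v‖⁻¹ • v = (√N)⁻¹ • v := fun v hv => by
    rw [norm_eq_sqrt_real_inner, hnorm v hv]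
  refine ⟨R, ?_⟩
  have : P.vertices = R ⁻¹' Y := by
    refine Set.Subset.antisymm ?_ fun z hz => ?_
    · rintro _ ⟨v, hvP, rfl⟩
      simp only [hv v hvP]
      exact hsub v hvP
    -- A further point of `Y` would have inner product at most t with every vertex, against the
    -- covering hypothesis.
    · by_contra hzP
      refine hcov z (hR.unit z hz) fun v hvP => ?_
      have h1 := hR.le z hz _ (hsub v hvP) (by
        rintro rfl
        exact hzP ⟨v, hvP, hv v hvP⟩)
      rw [inner_smul_right, inv_mul_le_iff₀ hq] at h1
      linarith
  rw [this, Set.image_preimage_eq _ R.surjective]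

/-- A closure property of a set of vectors in terms of coordinates. -/
theorem mem_of_coordinates {Y : Set 𝔼} {N t s : ℝ}
    (h : ∀ x ∈ Y, ∀ y ∈ Y, inner ℝ x y = t → ∀ z, inner ℝ z z = N → inner ℝ x z = t →
      inner ℝ y z = s → z ∈ Y) {a b c a' b' c' a'' b'' c'' : ℝ}
    (hx : !₂[a, b, c] ∈ Y) (hy : !₂[a', b', c'] ∈ Y) (hxy : a * a' + b * b' + c * c' = t)
    (hz : a'' * a'' + b'' * b'' + c'' * c'' = N) (hxz : a * a'' + b * b'' + c * c'' = t)
    (hyz : a' * a'' + b' * b'' + c' * c'' = s) : !₂[a'', b'', c''] ∈ Y := by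
  refine h _ hx _ hy ?_ _ ?_ ?_ ?_ <;> rw [real_inner_fin_three] <;> simpa

namespace IsNearestClosed

variable {Y : Set 𝔼}

theorem exists_tetrahedron (h : IsNearestClosed Y (-1 / 3) (-1 / 3)) :
    ∃ R : 𝔼 ≃ₗᵢ[ℝ] 𝔼, R '' SchemePolyhedron.tetrahedron.vertices = Y := by
  have hraw : ∀ v : 𝔼, v ∈ SchemePolyhedron.tetrahedron.rawVertices ↔ v = !₂[1, 1, 1] ∨
      v = !₂[1, -1, -1] ∨ v = !₂[-1, 1, -1] ∨ v = !₂[-1, -1, 1] := by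
    intro v
    constructor
    · rintro ⟨hv, h1⟩
      obtain ⟨p, q, r, hp, hq, hr, hv⟩ := mem_cyclicSigned_iff.1 hv
      simp only [or_self] at hv
      subst hv
      replace h1 : p * 1 * (q * 1) * (r * 1) = 1 := h1
      rcases hp with rfl | rfl <;> rcases hq with rfl | rfl <;> rcases hr with rfl | rfl <;>
        first | (norm_num; done) | norm_num at h1
    · have hc : ∀ p q r : ℝ, (p = 1 ∨ p = -1) → (q = 1 ∨ q = -1) → (r = 1 ∨ r = -1) →
          p * q * r = 1 → !₂[p, q, r] ∈ SchemePolyhedron.tetrahedron.rawVertices :=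
        fun p q r hp hq hr h1 =>
          ⟨mem_cyclicSigned_iff.2 ⟨p, q, r, hp, hq, hr, by simp⟩, by simpa using h1⟩
      rintro (rfl | rfl | rfl | rfl) <;> exact hc _ _ _ (by simp) (by simp) (by simp) (by norm_num)
  refine h.exists_image_vertices_eq (by norm_num) _ (N := 3) (by norm_num) ?_
    (a := !₂[1, 1, 1]) (b := !₂[1, -1, -1]) ?_ ?_ ?_ ?_ ?_
  · intro v hv
    rcases (hraw v).1 hv with rfl | rfl | rfl | rfl <;> rw [inner_mk_mk] <;> norm_num
  · rw [inner_mk_mk]; norm_num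
  · rw [inner_mk_mk]; norm_num
  · rw [inner_mk_mk]; norm_num
  -- The four vertices sum to zero, so their inner products with z cannot all be negative.
  · intro z _ hv
    have h1 := hv _ ((hraw _).2 (Or.inl rfl))
    have h2 := hv _ ((hraw _).2 (Or.inr (Or.inl rfl)))
    have h3 := hv _ ((hraw _).2 (Or.inr (Or.inr (Or.inl rfl))))
    have h4 := hv _ ((hraw _).2 (Or.inr (Or.inr (Or.inr rfl))))
    have h5 : 0 < √(3 : ℝ) := by positivity
    simp only [real_inner_fin_three] at h1 h2 h3 h4
    simp at h1 h2 h3 h4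
    linarith
  · intro Y' h1 h2 hY
    have hD := fun {a b c a' b' c' a'' b'' c''} =>
      mem_of_coordinates hY (a := a) (b := b) (c := c) (a' := a') (b' := b') (c' := c')
        (a'' := a'') (b'' := b'') (c'' := c'')
    intro v hv
    rcases (hraw v).1 hv with rfl | rfl | rfl | rfl
    · exact h1
    · exact h2
    · exact hD h1 h2 (by norm_num) (by norm_num) (by norm_num) (by norm_num)
    · exact hD h1 h2 (by norm_num) (by norm_num) (by norm_num) (by norm_num)

theorem exists_octahedron (h : IsNearestClosed Y 0 0) :
    ∃ R : 𝔼 ≃ₗᵢ[ℝ] 𝔼, R '' SchemePolyhedron.octahedron.vertices = Y := by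
  have hraw : ∀ v : 𝔼, v ∈ SchemePolyhedron.octahedron.rawVertices ↔ ∃ p : ℝ, (p = 1 ∨ p = -1) ∧
      (v = !₂[p, 0, 0] ∨ v = !₂[0, p, 0] ∨ v = !₂[0, 0, p]) := by
    intro v
    refine mem_cyclicSigned_iff.trans ⟨?_, ?_⟩
    · rintro ⟨p, q, r, hp, hq, hr, hv⟩
      rcases hv with rfl | rfl | rfl
      · exact ⟨p, hp, by simp⟩
      · exact ⟨r, hr, by simp⟩
      · exact ⟨q, hq, by simp⟩
    · rintro ⟨p, hp, rfl | rfl | rfl⟩ <;> exact ⟨p, p, p, hp, hp, hp, by simp⟩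
  refine h.exists_image_vertices_eq (by norm_num) _ (N := 1) (by norm_num) ?_
    (a := !₂[1, 0, 0]) (b := !₂[0, 1, 0]) ?_ ?_ ?_ ?_ ?_
  · intro v hv
    obtain ⟨p, rfl | rfl, rfl | rfl | rfl⟩ := (hraw v).1 hv <;> rw [inner_mk_mk] <;> norm_num
  · rw [inner_mk_mk]; norm_num
  · rw [inner_mk_mk]; norm_num
  · rw [inner_mk_mk]; norm_num
  · intro z hz hv
    have h0 : ∀ p : ℝ, (p = 1 ∨ p = -1) → z 0 * p ≤ 0 ∧ z 1 * p ≤ 0 ∧ z 2 * p ≤ 0 := by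
      intro p hp
      have h1 := hv _ ((hraw _).2 ⟨p, hp, Or.inl rfl⟩)
      have h2 := hv _ ((hraw _).2 ⟨p, hp, Or.inr (Or.inl rfl)⟩)
      have h3 := hv _ ((hraw _).2 ⟨p, hp, Or.inr (Or.inr rfl)⟩)
      simp only [real_inner_fin_three] at h1 h2 h3
      simp at h1 h2 h3
      exact ⟨h1, h2, h3⟩
    obtain ⟨h1, h2, h3⟩ := h0 1 (Or.inl rfl)
    obtain ⟨h1', h2', h3'⟩ := h0 (-1) (Or.inr rfl)
    have e1 : z 0 = 0 := by linarith
    have e2 : z 1 = 0 := by linarith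
    have e3 : z 2 = 0 := by linarith
    rw [real_inner_fin_three, e1, e2, e3] at hz
    norm_num at hz
  · intro Y' h1 h2 hY
    have hD := fun {a b c a' b' c' a'' b'' c''} =>
      mem_of_coordinates hY (a := a) (b := b) (c := c) (a' := a') (b' := b') (c' := c')
        (a'' := a'') (b'' := b'') (c'' := c'')
    have h3 : !₂[0, 0, 1] ∈ Y' := hD h1 h2 (by norm_num) (by norm_num) (by norm_num) (by norm_num)
    have h4 : !₂[0, 0, -1] ∈ Y' := hD h1 h2 (by norm_num) (by norm_num) (by norm_num) (by norm_num)
    have h5 : !₂[0, -1, 0] ∈ Y' := hD h1 h3 (by norm_num) (by norm_num) (by norm_num) (by norm_num)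
    have h6 : !₂[-1, 0, 0] ∈ Y' := hD h2 h3 (by norm_num) (by norm_num) (by norm_num) (by norm_num)
    intro v hv
    obtain ⟨p, rfl | rfl, rfl | rfl | rfl⟩ := (hraw v).1 hv <;> assumption

theorem exists_cube (h : IsNearestClosed Y (1 / 3) (-1 / 3)) :
    ∃ R : 𝔼 ≃ₗᵢ[ℝ] 𝔼, R '' SchemePolyhedron.cube.vertices = Y := by
  have hraw : ∀ v : 𝔼, v ∈ SchemePolyhedron.cube.rawVertices ↔ ∃ p q r : ℝ, (p = 1 ∨ p = -1) ∧
      (q = 1 ∨ q = -1) ∧ (r = 1 ∨ r = -1) ∧ v = !₂[p, q, r] := by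
    intro v
    refine mem_cyclicSigned_iff.trans ?_
    simp
  refine h.exists_image_vertices_eq (by norm_num) _ (N := 3) (by norm_num) ?_
    (a := !₂[1, 1, 1]) (b := !₂[1, 1, -1]) ?_ ?_ ?_ ?_ ?_
  · intro v hv
    obtain ⟨p, q, r, rfl | rfl, rfl | rfl, rfl | rfl, rfl⟩ := (hraw v).1 hv <;>
      rw [inner_mk_mk] <;> norm_num
  · rw [inner_mk_mk]; norm_num
  · rw [inner_mk_mk]; norm_num
  · rw [inner_mk_mk]; norm_num
  · intro z hz hv
    have h0 : ∀ p q r : ℝ, (p = 1 ∨ p = -1) → (q = 1 ∨ q = -1) → (r = 1 ∨ r = -1) →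
        z 0 * p + z 1 * q + z 2 * r ≤ 1 / 3 * √3 := by
      intro p q r hp hq hr
      have h1 := hv _ ((hraw _).2 ⟨p, q, r, hp, hq, hr, rfl⟩)
      rw [real_inner_fin_three] at h1
      simpa using h1
    have hs : ∀ q r : ℝ, (q = 1 ∨ q = -1) → (r = 1 ∨ r = -1) →
        (z 0 + z 1 * q + z 2 * r) ^ 2 ≤ 1 / 3 := by
      intro q r hq hr
      have h1 := h0 1 q r (Or.inl rfl) hq hr
      have h2 := h0 (-1) (-q) (-r) (Or.inr rfl) (by rcases hq with rfl | rfl <;> simp)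
        (by rcases hr with rfl | rfl <;> simp)
      have h3 : √(3 : ℝ) ^ 2 = 3 := Real.sq_sqrt (by norm_num)
      have h4 := sq_le_sq' (a := z 0 + z 1 * q + z 2 * r) (b := 1 / 3 * √3) (by linarith)
        (by linarith)
      nlinarith
    -- The squared inner products with the four diagonals sum to 4|z|² = 4, but the bounds allow
    -- only 4/3.
    have e1 := hs 1 1 (by simp) (by simp)
    have e2 := hs 1 (-1) (by simp) (by simp)
    have e3 := hs (-1) 1 (by simp) (by simp)
    have e4 := hs (-1) (-1) (by simp) (by simp)
    rw [real_inner_fin_three] at hz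
    nlinarith
  · intro Y' h1 h2 hY
    have hD := fun {a b c a' b' c' a'' b'' c''} =>
      mem_of_coordinates hY (a := a) (b := b) (c := c) (a' := a') (b' := b') (c' := c')
        (a'' := a'') (b'' := b'') (c'' := c'')
    have h3 : !₂[1, -1, 1] ∈ Y' := hD h1 h2 (by norm_num) (by norm_num) (by norm_num) (by norm_num)
    have h4 : !₂[-1, 1, 1] ∈ Y' := hD h1 h2 (by norm_num) (by norm_num) (by norm_num) (by norm_num)
    have h5 : !₂[1, -1, -1] ∈ Y' := hD h2 h1 (by norm_num) (by norm_num) (by norm_num) (by norm_num)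
    have h6 : !₂[-1, 1, -1] ∈ Y' := hD h2 h1 (by norm_num) (by norm_num) (by norm_num) (by norm_num)
    have h7 : !₂[-1, -1, 1] ∈ Y' := hD h3 h1 (by norm_num) (by norm_num) (by norm_num) (by norm_num)
    have h8 : !₂[-1, -1, -1] ∈ Y' := hD h5 h2 (by norm_num) (by norm_num) (by norm_num) (by norm_num)
    intro v hv
    obtain ⟨p, q, r, rfl | rfl, rfl | rfl, rfl | rfl, rfl⟩ := (hraw v).1 hv <;> assumption

theorem exists_icosahedron (h : IsNearestClosed Y (√5 / 5) (√5 / 5)) :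
    ∃ R : 𝔼 ≃ₗᵢ[ℝ] 𝔼, R '' SchemePolyhedron.icosahedron.vertices = Y := by
  have hraw : ∀ v : 𝔼, v ∈ SchemePolyhedron.icosahedron.rawVertices ↔ ∃ p q : ℝ,
      (p = 1 ∨ p = -1) ∧ (q = 1 ∨ q = -1) ∧ (v = !₂[0, p, q * Real.goldenRatio] ∨
      v = !₂[p, q * Real.goldenRatio, 0] ∨ v = !₂[q * Real.goldenRatio, 0, p]) := by
    intro v
    refine mem_cyclicSigned_iff.trans ⟨?_, ?_⟩
    · rintro ⟨p, q, r, hp, hq, hr, hv⟩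
      rcases hv with rfl | rfl | rfl
      · exact ⟨q, r, hq, hr, by simp⟩
      · exact ⟨p, q, hp, hq, by simp⟩
      · exact ⟨r, p, hr, hp, by simp⟩
    · rintro ⟨p, q, hp, hq, rfl | rfl | rfl⟩
      · exact ⟨p, p, q, hp, hp, hq, by simp⟩
      · exact ⟨p, q, p, hp, hq, hp, by simp⟩
      · exact ⟨q, p, p, hq, hp, hp, by simp⟩
  -- After this substitution only φ² = φ + 1 and φ > 0 are needed.
  have hφ5 : √5 = 2 * Real.goldenRatio - 1 := by unfold Real.goldenRatio; ring
  have hφ := Real.goldenRatio_sq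
  have hφ0 := Real.goldenRatio_pos
  rw [hφ5] at h
  generalize Real.goldenRatio = φ at *
  have ht : (φ + 2) * ((2 * φ - 1) / 5) = φ := by linear_combination 2 / 5 * hφ
  refine h.exists_image_vertices_eq (by nlinarith) _ (N := φ + 2) (by linarith) ?_
    (a := !₂[0, 1, φ]) (b := !₂[0, -1, φ]) ?_ ?_ ?_ ?_ ?_
  · intro v hv
    obtain ⟨p, q, rfl | rfl, rfl | rfl, rfl | rfl | rfl⟩ := (hraw v).1 hv <;>
      rw [inner_mk_mk] <;> linear_combination hφ
  · rw [inner_mk_mk]; linear_combination hφ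
  · rw [inner_mk_mk]; linear_combination hφ
  · rw [inner_mk_mk, ht]; linear_combination hφ
  · intro z hz hv
    have h0 : ∀ p q : ℝ, (p = 1 ∨ p = -1) → (q = 1 ∨ q = -1) →
        z 1 * p + z 2 * (q * φ) ≤ (2 * φ - 1) / 5 * √(φ + 2) ∧
        z 0 * p + z 1 * (q * φ) ≤ (2 * φ - 1) / 5 * √(φ + 2) ∧
        z 0 * (q * φ) + z 2 * p ≤ (2 * φ - 1) / 5 * √(φ + 2) := by
      intro p q hp hq
      have h1 := hv _ ((hraw _).2 ⟨p, q, hp, hq, Or.inl rfl⟩)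
      have h2 := hv _ ((hraw _).2 ⟨p, q, hp, hq, Or.inr (Or.inl rfl)⟩)
      have h3 := hv _ ((hraw _).2 ⟨p, q, hp, hq, Or.inr (Or.inr rfl)⟩)
      simp only [real_inner_fin_three] at h1 h2 h3
      simp at h1 h2 h3
      exact ⟨h1, h2, h3⟩
    have hN : ((2 * φ - 1) / 5 * √(φ + 2)) ^ 2 = (φ + 2) / 5 := by
      rw [mul_pow, Real.sq_sqrt (by linarith)]
      linear_combination (4 / 25 * φ + 8 / 25) * hφ
    have hs : ∀ q : ℝ, (q = 1 ∨ q = -1) → (z 1 + z 2 * (q * φ)) ^ 2 ≤ (φ + 2) / 5 ∧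
        (z 0 + z 1 * (q * φ)) ^ 2 ≤ (φ + 2) / 5 ∧ (z 0 * (q * φ) + z 2) ^ 2 ≤ (φ + 2) / 5 := by
      intro q hq
      obtain ⟨h1, h2, h3⟩ := h0 1 q (Or.inl rfl) hq
      obtain ⟨h1', h2', h3'⟩ := h0 (-1) (-q) (Or.inr rfl) (by rcases hq with rfl | rfl <;> simp)
      rw [← hN]
      exact ⟨sq_le_sq' (by linarith) (by linarith), sq_le_sq' (by linarith) (by linarith),
        sq_le_sq' (by linarith) (by linarith)⟩
    -- The squares for the six diagonals sum to 2(1 + φ²)|z|² = 2(φ + 2), but the bounds allow only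
    -- 6(φ + 2)/5.
    obtain ⟨e1, e2, e3⟩ := hs 1 (by simp)
    obtain ⟨e4, e5, e6⟩ := hs (-1) (by simp)
    rw [real_inner_fin_three] at hz
    have e7 : φ ^ 2 * (z 0 * z 0 + z 1 * z 1 + z 2 * z 2) = φ ^ 2 := by rw [hz, mul_one]
    nlinarith
  · rw [ht]
    intro Y' h1 h2 hY
    have hD := fun {a b c a' b' c' a'' b'' c''} =>
      mem_of_coordinates hY (a := a) (b := b) (c := c) (a' := a') (b' := b') (c' := c')
        (a'' := a'') (b'' := b'') (c'' := c'')
    have h3 : !₂[φ, 0, 1] ∈ Y' := hD h1 h2 (by linarith) (by linarith) (by linarith) (by linarith)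
    have h4 : !₂[-φ, 0, 1] ∈ Y' := hD h1 h2 (by linarith) (by linarith) (by linarith) (by linarith)
    have h5 : !₂[1, φ, 0] ∈ Y' := hD h1 h3 (by linarith) (by linarith) (by linarith) (by linarith)
    have h6 : !₂[-1, φ, 0] ∈ Y' := hD h1 h4 (by linarith) (by linarith) (by linarith) (by linarith)
    have h7 : !₂[1, -φ, 0] ∈ Y' := hD h2 h3 (by linarith) (by linarith) (by linarith) (by linarith)
    have h8 : !₂[-1, -φ, 0] ∈ Y' := hD h2 h4 (by linarith) (by linarith) (by linarith) (by linarith)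
    have h9 : !₂[φ, 0, -1] ∈ Y' := hD h3 h5 (by linarith) (by linarith) (by linarith) (by linarith)
    have h10 : !₂[-φ, 0, -1] ∈ Y' := hD h4 h6 (by linarith) (by linarith) (by linarith) (by linarith)
    have h11 : !₂[0, 1, -φ] ∈ Y' := hD h5 h9 (by linarith) (by linarith) (by linarith) (by linarith)
    have h12 : !₂[0, -1, -φ] ∈ Y' := hD h7 h9 (by linarith) (by linarith) (by linarith) (by linarith)
    intro v hv
    obtain ⟨p, q, rfl | rfl, rfl | rfl, rfl | rfl | rfl⟩ := (hraw v).1 hv <;>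
      simp only [one_mul, neg_one_mul] <;> assumption

end IsNearestClosed

end

-- Nonzero third moments: all inner products are -1/3

theorem EuclideanSpace.exists_orthonormalBasis_apply_zero {x : 𝔼} (hx : inner ℝ x x = (1 : ℝ)) :
    ∃ b : OrthonormalBasis (Fin 3) ℝ 𝔼, b 0 = x := by
  let v : Fin 3 → 𝔼 := fun _ => x
  have hv : Orthonormal ℝ (({0} : Set (Fin 3)).domRestrict v) := by
    rw [orthonormal_iff_ite]
    rintro ⟨i, rfl⟩ ⟨j, rfl⟩
    exact hx
  obtain ⟨b, hb⟩ := hv.exists_orthonormalBasis_extension_of_card_eq (by simp)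
  exact ⟨b, hb 0 rfl⟩

namespace SymmetricAssociationScheme.IsSphericalModel

variable {X : Type*} [Fintype X] {d : ℕ} {S : SymmetricAssociationScheme X d} {V : X → 𝔼}

/-- If the moments of degree three do not all vanish, then any two points have inner product
`-1/3`. -/
theorem inner_eq_of_cubic_ne_zero (h : S.IsSphericalModel V) {l : ℝ} (hl0 : l ≠ 0)
    (hl : ∀ x u, ∑ z, (inner ℝ (V x) (V z)) ^ 2 * inner ℝ (V z) u = l * inner ℝ (V x) u)
    {x y : X} (hxy : x ≠ y) : inner ℝ (V x) (V y) = -1 / 3 := by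
  obtain ⟨b, hb⟩ := EuclideanSpace.exists_orthonormalBasis_apply_zero (h.norm_one x)
  let c : X → Fin 3 → ℝ := fun z i => inner ℝ (V z) (b i)
  -- The third moment tensor in a basis starting with `V x`. It is symmetric, it is traceless
  -- because the points are unit vectors with sum zero, and contracting it with itself in two
  -- indices gives a multiple of the identity (`hiso`).
  let T : Fin 3 → Fin 3 → Fin 3 → ℝ := fun i j k => ∑ z, c z i * c z j * c z k
  have hc : ∀ z w, inner ℝ (V z) (V w) = c z 0 * c w 0 + c z 1 * c w 1 + c z 2 * c w 2 :=
    fun z w => by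
      rw [← b.sum_inner_mul_inner, Fin.sum_univ_three]
      simp only [c, real_inner_comm]
  have hbij : ∀ i j, inner ℝ (b i) (b j) = if i = j then (1 : ℝ) else 0 :=
    orthonormal_iff_ite.1 b.orthonormal
  have hT0 : ∀ k, T 0 0 k = if 0 = k then l else 0 := fun k => by
    have h1 := hl x (b k)
    rw [← hb, hbij, mul_ite, mul_one, mul_zero] at h1
    rw [← h1]
    refine Finset.sum_congr rfl fun z _ => ?_
    rw [real_inner_comm (V z)]
    ring
  have htr : ∀ k, T 0 0 k + T 1 1 k + T 2 2 k = 0 := fun k => by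
    have h1 := h.sum_inner_eq_zero (b k)
    rw [← h1]
    simp only [T, ← Finset.sum_add_distrib]
    refine Finset.sum_congr rfl fun z _ => ?_
    have h2 := hc z z
    rw [h.norm_one] at h2
    change _ = c z k
    linear_combination (-c z k) * h2
  have hiso : ∀ i i', ∑ j, ∑ k, T i j k * T i' j k =
      l * ((Fintype.card X : ℝ) / 3 * inner ℝ (b i) (b i')) := by
    intro i i'
    have h1 : ∑ z, c z i * ∑ w, (inner ℝ (V z) (V w)) ^ 2 * c w i' =
        l * ((Fintype.card X : ℝ) / 3 * inner ℝ (b i) (b i')) := by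
      rw [← h.moment, Finset.mul_sum]
      refine Finset.sum_congr rfl fun z _ => ?_
      rw [hl]
      change c z i * _ = l * (c z i * _)
      ring
    rw [← h1]
    simp only [Fin.sum_univ_three, T, Finset.mul_sum, ← Finset.sum_add_distrib]
    rw [Finset.sum_comm]
    refine Finset.sum_congr rfl fun w _ => ?_
    simp only [Finset.sum_mul, ← Finset.sum_add_distrib]
    refine Finset.sum_congr rfl fun z _ => ?_
    rw [hc]
    ring
  have hsymm : ∀ i j k, T i j k = T j i k ∧ T i j k = T i k j := fun i j k =>
    ⟨Finset.sum_congr rfl fun z _ => by ring, Finset.sum_congr rfl fun z _ => by ring⟩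
  have t001 : T 0 0 1 = 0 := by simp [hT0]
  have t002 : T 0 0 2 = 0 := by simp [hT0]
  have t000 : T 0 0 0 = l := by simp [hT0]
  have e0 := htr 0
  have e1 := htr 1
  have e2 := htr 2
  have f11 := hiso 1 1
  have f22 := hiso 2 2
  have f12 := hiso 1 2
  simp only [Fin.sum_univ_three, hbij, if_true] at f11 f22 f12
  rw [if_neg (by decide)] at f12
  -- Symmetry brings the entries that differ by a permutation of indices to a common form, so that
  -- the linear combinations below close.
  rw [(hsymm 1 1 0).2, (hsymm 1 0 1).1, (hsymm 2 2 0).2, (hsymm 2 0 2).1, t000] at e0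
  rw [t001, (hsymm 2 2 1).2, (hsymm 2 1 2).1] at e1
  rw [t002, (hsymm 1 1 2).2] at e2
  rw [(hsymm 1 0 0).1, (hsymm 1 0 1).1, (hsymm 1 0 2).1, (hsymm 1 1 0).2, (hsymm 1 0 1).1,
    (hsymm 1 2 0).2, (hsymm 1 0 2).1, (hsymm 0 1 0).2, t001, (hsymm 1 1 2).2] at f11
  rw [(hsymm 2 0 0).1, (hsymm 2 0 1).1, (hsymm 2 0 2).1, (hsymm 2 1 0).2, (hsymm 2 0 1).1,
    (hsymm 2 2 0).2, (hsymm 2 0 2).1, (hsymm 0 2 0).2, t002, (hsymm 0 2 1).2, (hsymm 2 1 1).1,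
    (hsymm 2 1 2).1, (hsymm 2 2 1).2, (hsymm 2 1 2).1] at f22
  rw [(hsymm 1 0 0).1, (hsymm 1 0 1).1, (hsymm 1 0 2).1, (hsymm 1 1 0).2, (hsymm 1 0 1).1,
    (hsymm 1 2 0).2, (hsymm 1 0 2).1, (hsymm 0 1 0).2, t001, (hsymm 1 1 2).2,
    (hsymm 2 0 0).1, (hsymm 2 0 1).1, (hsymm 2 0 2).1, (hsymm 2 1 0).2, (hsymm 2 0 1).1,
    (hsymm 2 2 0).2, (hsymm 2 0 2).1, (hsymm 0 2 0).2, t002, (hsymm 0 2 1).2, (hsymm 2 1 1).1,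
    (hsymm 2 1 2).1, (hsymm 2 2 1).2, (hsymm 2 1 2).1] at f12
  have hq : T 0 1 2 = 0 := by
    have : l * T 0 1 2 = 0 := by
      linear_combination T 0 1 2 * e0 - f12 / 2 + T 1 2 1 * e1 / 2 + T 1 2 2 * e2 / 2
    exact (mul_eq_zero.1 this).resolve_left hl0
  have hp : T 0 1 1 = -l / 2 ∧ T 0 2 2 = -l / 2 := by
    have h1 : l * (T 0 1 1 - T 0 2 2) = 0 := by
      linear_combination (T 0 1 1 - T 0 2 2) * e0 - f11 / 2 + f22 / 2 +
        (T 1 1 1 - T 1 2 2) * e1 / 2 + (T 1 2 1 - T 2 2 2) * e2 / 2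
    have h2 := (mul_eq_zero.1 h1).resolve_left hl0
    constructor <;> linarith
  -- With T determined in its first slot, the cubic identity at y and x reads l(3c² - 1)/2 = l c for
  -- c = ⟨y, x⟩, whose roots are 1 and -1/3.
  have h1 := hl y (V x)
  have h2 : ∑ z, (inner ℝ (V y) (V z)) ^ 2 * inner ℝ (V z) (V x) =
      c y 0 ^ 2 * T 0 0 0 + c y 1 ^ 2 * T 0 1 1 + c y 2 ^ 2 * T 0 2 2 +
      2 * (c y 0 * c y 1 * T 0 0 1 + c y 0 * c y 2 * T 0 0 2 + c y 1 * c y 2 * T 0 1 2) := by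
    simp only [T, Finset.mul_sum, ← Finset.sum_add_distrib]
    refine Finset.sum_congr rfl fun z _ => ?_
    rw [hc y z, ← hb]
    change _ * c z 0 = _
    ring
  have h3 := hc y y
  have h4 : inner ℝ (V y) (V x) = c y 0 := by rw [← hb]
  have h5 : c y 0 ≠ 1 := fun h5 => hxy ((h.inner_eq_one_iff.1 (h4.trans h5)).symm)
  rw [h.norm_one] at h3
  rw [h2, t000, t001, t002, hq, hp.1, hp.2, h4] at h1
  have h6 : l * ((3 * c y 0 + 1) * (c y 0 - 1)) = 0 := by
    linear_combination 2 * h1 - l * h3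
  rcases mul_eq_zero.1 ((mul_eq_zero.1 h6).resolve_left hl0) with e | e
  · rw [real_inner_comm, h4]
    linarith
  · exact absurd (by linarith) h5

end SymmetricAssociationScheme.IsSphericalModel

-- Point sets on the circle

/-- Two unit vectors in the same of four sectors, which together with a sector of `120` degrees
around the first axis cover the plane, form an angle of at most `60` degrees. -/
theorem half_le_of_same_sector {p q p' q' : ℝ} (h : p ^ 2 + q ^ 2 = 1) (h' : p' ^ 2 + q' ^ 2 = 1)
    (hp : p < 1 / 2) (hp' : p' < 1 / 2) (hq : 0 ≤ q ↔ 0 ≤ q') (hs : -1 / 2 ≤ p ↔ -1 / 2 ≤ p') :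
    1 / 2 ≤ p * p' + q * q' := by
  wlog hq0 : 0 ≤ q generalizing q q'
  · have := this (q := -q) (q' := -q') (by linarith) (by linarith) (by
      push Not at hq0
      have h1 : ¬ 0 ≤ q' := fun h1 => absurd (hq.2 h1) (by linarith)
      constructor <;> intro <;> linarith) (by linarith)
    linarith
  have hq0' := hq.1 hq0
  by_cases hp1 : -1 / 2 ≤ p
  · have hp1' := hs.1 hp1
    have e1 : 3 / 4 ≤ q ^ 2 := by nlinarith
    have e2 : 3 / 4 ≤ q' ^ 2 := by nlinarith
    have e3 : 3 / 4 ≤ q * q' := by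
      refine abs_le_of_sq_le_sq' (a := 3 / 4) ?_ (by positivity) |>.2
      rw [mul_pow]
      nlinarith
    have e4 : -(1 / 4) ≤ p * p' := by
      have : (p * p') ^ 2 ≤ (1 / 4) ^ 2 := by
        rw [mul_pow]
        have : p ^ 2 ≤ 1 / 4 := by linarith
        have : p' ^ 2 ≤ 1 / 4 := by linarith
        nlinarith [sq_nonneg p, sq_nonneg p']
      exact (abs_le_of_sq_le_sq' this (by norm_num)).1
    linarith
  · have hp1' : ¬ -1 / 2 ≤ p' := fun h1 => hp1 (hs.2 h1)
    push Not at hp1 hp1'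
    have key : ∀ p q p' q' : ℝ, p ^ 2 + q ^ 2 = 1 → p' ^ 2 + q' ^ 2 = 1 → 0 ≤ q → q ≤ q' →
        p < -1 / 2 → p' < -1 / 2 → 1 / 2 ≤ p * p' + q * q' := by
      intro p q p' q' h h' hq hqq hp hp'
      have e1 : q ^ 2 ≤ q * q' := by nlinarith
      have e2 : 1 + p ≤ q ^ 2 := by nlinarith
      have e3 : 0 ≤ 1 + p := by nlinarith
      have e4 : 0 ≤ 1 + p' := by nlinarith
      nlinarith [mul_nonneg e3 e4]
    rcases le_total q q' with hqq | hqq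
    · exact key p q p' q' h h' hq0 hqq hp1 hp1'
    · have := key p' q' p q h' h hq0' hqq hp1' hp1
      linarith

/-- There are at most five points on a circle with mutual angles greater than `60` degrees. -/
theorem card_le_five_of_forall_lt_half {ι : Type*} {s : Finset ι} {α β : ι → ℝ}
    (hn : ∀ i ∈ s, α i ^ 2 + β i ^ 2 = 1)
    (h : ∀ i ∈ s, ∀ j ∈ s, i ≠ j → α i * α j + β i * β j < 1 / 2) : s.card ≤ 5 := by
  classical
  by_contra hs
  push Not at hs
  obtain ⟨o, ho⟩ : s.Nonempty := Finset.card_pos.1 (by omega)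
  -- Coordinates rotated so that point o lies on the first axis; the other five or more points fall
  -- into four sectors.
  let p : ι → ℝ := fun i => α o * α i + β o * β i
  let q : ι → ℝ := fun i => α o * β i - β o * α i
  obtain ⟨i, hi, j, hj, hij, he⟩ := Finset.exists_ne_map_eq_of_card_lt_of_maps_to
    (s := s.erase o) (t := (Finset.univ : Finset (Prop × Prop)))
    (f := fun i => (0 ≤ q i, -1 / 2 ≤ p i))
    (by
      rw [Finset.card_erase_of_mem ho]
      have : (Finset.univ : Finset (Prop × Prop)).card = 4 := by
        rw [Finset.card_univ, Fintype.card_prod, Fintype.card_prop]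
      omega)
    (fun _ _ => Finset.mem_univ _)
  rw [Finset.mem_erase] at hi hj
  simp only [Prod.mk.injEq, eq_iff_iff] at he
  have hpq : ∀ k ∈ s, p k ^ 2 + q k ^ 2 = 1 := fun k hk => by
    have h1 := hn o ho
    have h2 := hn k hk
    simp only [p, q]
    linear_combination (α k ^ 2 + β k ^ 2) * h1 + h2
  have h1 := half_le_of_same_sector (hpq i hi.2) (hpq j hj.2) (h o ho i hi.2 hi.1.symm)
    (h o ho j hj.2 hj.1.symm) he.1 he.2
  have h2 := h i hi.2 j hj.2 hij
  have h3 : p i * p j + q i * q j = α i * α j + β i * β j := by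
    have h4 := hn o ho
    simp only [p, q]
    linear_combination (α i * α j + β i * β j) * h4
  linarith

/-- A family of points on the unit circle whose moments of degree one and two are those of the
circle. -/
structure IsPlanarDesign {ι : Type*} (s : Finset ι) (α β : ι → ℝ) : Prop where
  norm_one : ∀ i ∈ s, α i ^ 2 + β i ^ 2 = 1
  sum_eq : ∀ a b, ∑ i ∈ s, (α i * a + β i * b) = 0
  sum_sq_eq : ∀ a b, ∑ i ∈ s, (α i * a + β i * b) ^ 2 = s.card / 2 * (a ^ 2 + b ^ 2)

namespace IsPlanarDesign

variable {ι : Type*} {s : Finset ι} {α β : ι → ℝ}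

theorem neg_one_le (h : IsPlanarDesign s α β) {i j : ι} (hi : i ∈ s) (hj : j ∈ s) :
    -1 ≤ α i * α j + β i * β j := by
  nlinarith [h.norm_one i hi, h.norm_one j hj, sq_nonneg (α i + α j), sq_nonneg (β i + β j)]

theorem sum_inner_eq (h : IsPlanarDesign s α β) [DecidableEq ι] {o : ι} (ho : o ∈ s) :
    ∑ i ∈ s.erase o, (α i * α o + β i * β o) = -1 := by
  have h1 := h.sum_eq (α o) (β o)
  rw [← Finset.add_sum_erase _ _ ho] at h1
  linarith [h.norm_one o ho]

theorem sum_inner_sq_eq (h : IsPlanarDesign s α β) [DecidableEq ι] {o : ι} (ho : o ∈ s) :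
    ∑ i ∈ s.erase o, (α i * α o + β i * β o) ^ 2 = s.card / 2 - 1 := by
  have h1 := h.sum_sq_eq (α o) (β o)
  rw [← Finset.add_sum_erase _ _ ho, ← sq, ← sq, h.norm_one o ho] at h1
  linarith

theorem three_le_card (h : IsPlanarDesign s α β) (hs : s.Nonempty) : 3 ≤ s.card := by
  classical
  obtain ⟨o, ho⟩ := hs
  have h1 := h.sum_inner_eq ho
  have h2 := h.sum_inner_sq_eq ho
  have h3 : (s.erase o).card = s.card - 1 := Finset.card_erase_of_mem ho
  have h4 : 0 < s.card := Finset.card_pos.2 ⟨o, ho⟩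
  by_contra hlt
  rcases (by omega : s.card = 1 ∨ s.card = 2) with e | e
  · rw [e] at h3
    rw [Finset.card_eq_zero.1 h3, Finset.sum_empty] at h1
    norm_num at h1
  · rw [e] at h3
    obtain ⟨i, hi⟩ := Finset.card_eq_one.1 h3
    rw [hi, Finset.sum_singleton] at h1 h2
    rw [h1, e] at h2
    norm_num at h2

/-- The smallest angle of a planar design is at most `120` degrees. -/
theorem neg_half_le (h : IsPlanarDesign s α β) (hs : s.Nonempty) {C : ℝ}
    (hC : ∀ i ∈ s, ∀ j ∈ s, i ≠ j → α i * α j + β i * β j ≤ C) : -1 / 2 ≤ C := by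
  classical
  have h3 := h.three_le_card hs
  obtain ⟨o, ho⟩ := hs
  have h1 := h.sum_inner_eq ho
  have h2 := h.sum_inner_sq_eq ho
  -- A linear programming bound: (c - C)(c + 1) is nonpositive on [-1, C], and its sum is fixed by
  -- the moments.
  have h4 : ∑ i ∈ s.erase o, ((α i * α o + β i * β o) - C) * ((α i * α o + β i * β o) + 1) ≤ 0 :=
    Finset.sum_nonpos fun i hi => by
      rw [Finset.mem_erase] at hi
      exact mul_nonpos_of_nonpos_of_nonneg (by linarith [hC i hi.2 o ho hi.1])
        (by linarith [h.neg_one_le hi.2 ho])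
  have h5 : ∑ i ∈ s.erase o, ((α i * α o + β i * β o) - C) * ((α i * α o + β i * β o) + 1) =
      (s.card / 2 - 1 : ℝ) + (1 - C) * (-1) - C * (s.card - 1) := by
    rw [← h2, ← h1, Finset.mul_sum]
    have : ((s.card : ℝ) - 1) = ∑ i ∈ s.erase o, (1 : ℝ) := by
      rw [Finset.sum_const, nsmul_eq_mul, mul_one, Finset.card_erase_of_mem ho,
        Nat.cast_sub (by omega), Nat.cast_one]
    rw [this, Finset.mul_sum, ← Finset.sum_add_distrib, ← Finset.sum_sub_distrib]
    exact Finset.sum_congr rfl fun i _ => by ring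
  have h6 : (3 : ℝ) ≤ s.card := by exact_mod_cast h3
  by_contra hlt
  push Not at hlt
  nlinarith

/-- In a planar design with smallest angle greater than `60` degrees, a point cannot always have
exactly one nearest point. -/
theorem not_forall_existsUnique (h : IsPlanarDesign s α β) (hs : s.Nonempty) {C : ℝ}
    (hC : ∀ i ∈ s, ∀ j ∈ s, i ≠ j → α i * α j + β i * β j ≤ C) (hC' : C < 1 / 2) :
    ¬ ∀ i ∈ s, ∃! j, j ∈ s ∧ α i * α j + β i * β j = C := by
  classical
  intro hu
  choose! g hg hgu using fun i hi => hu i hi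
  simp only at hg hgu
  have hne : ∀ i ∈ s, g i ≠ i := fun i hi e => by
    have h1 := (hg i hi).2
    rw [e] at h1
    linarith [h.norm_one i hi]
  have hgg : ∀ i ∈ s, g (g i) = i := fun i hi => by
    refine (hgu (g i) (hg i hi).1 i ⟨hi, ?_⟩).symm
    rw [← (hg i hi).2]
    ring
  have h5 := card_le_five_of_forall_lt_half h.norm_one
    fun i hi j hj hij => (hC i hi j hj hij).trans_lt hC'
  have h3 := h.three_le_card hs
  -- Being the unique nearest point is mutual, so `g` is an involution without fixed points. The
  -- cardinality is thus even and between 3 and 5.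
  have heven : (s.card : ZMod 2) = 0 := by
    have := Finset.sum_involution (s := s) (f := fun _ => (1 : ZMod 2)) (fun i _ => g i)
      (fun _ _ => by decide) (fun i hi _ => hne i hi) (fun i hi => (hg i hi).1) hgg
    simpa using this
  rw [ZMod.natCast_eq_zero_iff] at heven
  have h4 : s.card = 4 := by omega
  obtain ⟨i, hi⟩ := hs
  obtain ⟨j, hj, hij⟩ : ∃ j ∈ s, j ∉ ({i, g i} : Finset ι) := by
    by_contra hcon
    push Not at hcon
    have := Finset.card_le_card (fun j hj => hcon j hj : s ⊆ {i, g i})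
    have := Finset.card_le_two (a := i) (b := g i)
    omega
  simp only [Finset.mem_insert, Finset.mem_singleton, not_or] at hij
  have hi' := (hg i hi).1
  have hj' := (hg j hj).1
  have hji : g j ≠ i := fun e => hij.2 (by rw [← e, hgg j hj])
  have hji' : g j ≠ g i := fun e => hij.1 (by rw [← hgg j hj, e, hgg i hi])
  have hs4 : s = {i, g i, j, g j} := by
    refine (Finset.eq_of_subset_of_card_le ?_ ?_).symm
    · intro k hk
      simp only [Finset.mem_insert, Finset.mem_singleton] at hk
      rcases hk with rfl | rfl | rfl | rfl <;> assumption
    · rw [h4, Finset.card_insert_of_notMem, Finset.card_insert_of_notMem,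
        Finset.card_insert_of_notMem, Finset.card_singleton]
      · simpa using (hne j hj).symm
      · simpa using ⟨Ne.symm hij.2, hji'.symm⟩
      · simpa using ⟨(hne i hi).symm, Ne.symm hij.1, hji.symm⟩
  have hsum : ∀ f : ι → ℝ, ∑ k ∈ s, f k = f i + f (g i) + f j + f (g j) := fun f => by
    rw [hs4, Finset.sum_insert, Finset.sum_insert, Finset.sum_insert, Finset.sum_singleton]
    · ring
    · simpa using (hne j hj).symm
    · simpa using ⟨Ne.symm hij.2, hji'.symm⟩
    · simpa using ⟨(hne i hi).symm, Ne.symm hij.1, hji.symm⟩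
  have l1 := h.sum_eq 1 0
  have l2 := h.sum_eq 0 1
  have l3 := h.sum_eq (α i) (β i)
  have q1 := h.sum_sq_eq (α i) (β i)
  have q2 := h.sum_sq_eq (α i + α (g i)) (β i + β (g i))
  rw [hsum] at l1 l2 l3 q1 q2
  rw [h4] at q1 q2
  have n1 := h.norm_one i hi
  have n2 := h.norm_one _ hi'
  have n3 := h.norm_one j hj
  have n4 := h.norm_one _ hj'
  have c1 := (hg i hi).2
  have c2 := (hg j hj).2
  have u1 := hgu i hi j
  have u2 := hgu i hi (g j)
  have b1 := h.neg_one_le hi hj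
  have b2 := hC i hi j hj (Ne.symm hij.1)
  set α' := α (g i)
  set β' := β (g i)
  set γ := α (g j)
  set δ := β (g j)
  have m1 : α i + α' = -(α j + γ) := by linarith
  have m2 : β i + β' = -(β j + δ) := by linarith
  have m3 : α i * (α i + α') + β i * (β i + β') = 1 + C := by linear_combination n1 + c1
  have m4 : α' * (α i + α') + β' * (β i + β') = 1 + C := by linear_combination n2 + c1
  have m5 : α j * (α i + α') + β j * (β i + β') = -(1 + C) := by
    rw [m1, m2]; linear_combination -n3 - c2
  have m6 : γ * (α i + α') + δ * (β i + β') = -(1 + C) := by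
    rw [m1, m2]; linear_combination -n4 - c2
  rw [m3, m4, m5, m6] at q2
  -- The second moment in the direction m of the sum of the first pair reads 4(1 + C)² = 2|m|² = 4(1
  -- + C).
  have hC0 : (1 + C) * C = 0 := by
    push_cast at q2
    linear_combination q2 / 4 + (n1 + n2 + 2 * c1) / 2
  rcases mul_eq_zero.1 hC0 with e | e
  -- If C = -1, every inner product of distinct points equals C, against uniqueness.
  · exact hij.2 (u1 ⟨hj, by linarith⟩)
  · subst e
    -- For C = 0 the two remaining inner products have sum -1 and sum of squares 1. One of them is 0
    -- = C, a second nearest point.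
    have e1 : α i * α j + β i * β j + (α i * γ + β i * δ) = -1 := by
      linear_combination l3 - n1 - c1
    have e2 : (α i * α j + β i * β j) * (α i * γ + β i * δ) = 0 := by
      have e3 : α i * α' + β i * β' = 0 := c1
      push_cast at q1
      linear_combination (α i * α j + β i * β j + (α i * γ + β i * δ) - 1) / 2 * e1 - q1 / 2 +
        (α i ^ 2 + β i ^ 2 - 1) / 2 * n1 + (α i * α' + β i * β') / 2 * e3
    rcases mul_eq_zero.1 e2 with e | e
    · exact hij.2 (u1 ⟨hj, e⟩)
    · exact hji' (u2 ⟨hj', e⟩)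

end IsPlanarDesign

-- Moments of the neighbourhood of a point

namespace SymmetricAssociationScheme.IsSphericalModel

variable {X : Type*} [Fintype X] {d : ℕ} {S : SymmetricAssociationScheme X d} {V : X → 𝔼}

theorem card_pos (_h : S.IsSphericalModel V) : (0 : ℝ) < Fintype.card X := by
  obtain ⟨x₀, -⟩ := S.nonempty 0
  have : Nonempty X := ⟨x₀⟩
  exact_mod_cast Fintype.card_pos

/-- The degree bound for linear polynomials gives a⟨x, z⟩ + b; summing over all z kills b because
the points have sum zero. -/
theorem exists_sum_inner_eq (h : S.IsSphericalModel V) (i : Fin (d + 1)) :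
    ∃ p : ℝ, ∀ x u, ∑ y with S.rel x y = i, inner ℝ (V y) u = p * inner ℝ (V x) u := by
  obtain ⟨q, hq, hqe⟩ := h.poly i Polynomial.X 1 Polynomial.natDegree_X_le
  obtain ⟨a, b, rfl⟩ := Polynomial.exists_eq_X_add_C_of_natDegree_le_one hq
  simp only [Polynomial.eval_add, Polynomial.eval_mul, Polynomial.eval_C, Polynomial.eval_X] at hqe
  obtain ⟨x₀, -⟩ := S.nonempty 0
  have hb : b = 0 := by
    have h1 : ∑ z, ∑ y with S.rel x₀ y = i, inner ℝ (V y) (V z) =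
        ∑ z, (a * inner ℝ (V x₀) (V z) + b) := Finset.sum_congr rfl fun z _ => hqe x₀ z
    rw [Finset.sum_comm, Finset.sum_add_distrib, ← Finset.mul_sum] at h1
    have h2 : ∀ y, ∑ z, inner ℝ (V y) (V z) = 0 := fun y => by
      rw [← inner_sum, h.sum_eq_zero, inner_zero_right]
    simp only [h2] at h1
    simpa [h.card_pos.ne'] using h1
  refine ⟨a, fun x u => ?_⟩
  have h1 : ∑ y with S.rel x y = i, V y = a • V x := h.ext_inner fun z => by
    rw [real_inner_comm, sum_inner, hqe, hb, add_zero, inner_smul_right, real_inner_comm]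
  rw [← sum_inner, h1, inner_smul_left]
  simp

/-- A quadratic form in the span of the squares of the points vanishes, if it vanishes in all
points. -/
theorem _root_.sum_mul_inner_sq_eq_zero {V : X → 𝔼} {w : X → ℝ}
    (hw : ∀ z, ∑ a, w a * inner ℝ (V a) (V z) ^ 2 = 0) (u : 𝔼) :
    ∑ a, w a * inner ℝ (V a) u ^ 2 = 0 := by
  -- The squared Frobenius norm of ∑ w_a V_a V_aᵀ is the w-weighted sum of the values of the form at
  -- the points.
  have h1 : ∑ i, ∑ j, (∑ a, w a * (V a i * V a j)) ^ 2 = 0 := by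
    have h2 : ∑ z, w z * ∑ a, w a * inner ℝ (V a) (V z) ^ 2 = 0 :=
      Finset.sum_eq_zero fun z _ => by rw [hw, mul_zero]
    rw [← h2]
    simp only [Fin.sum_univ_three, sq, Finset.mul_sum, ← Finset.sum_add_distrib]
    refine Finset.sum_congr rfl fun z _ => ?_
    simp only [Finset.sum_mul, ← Finset.sum_add_distrib]
    refine Finset.sum_congr rfl fun a _ => ?_
    rw [EuclideanSpace.real_inner_fin_three]
    ring
  have h2 : ∀ i j, ∑ a, w a * (V a i * V a j) = 0 := fun i j => by
    have h3 := (Finset.sum_eq_zero_iff_of_nonneg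
      (fun i _ => Finset.sum_nonneg fun j _ => sq_nonneg _)).1 h1 i (Finset.mem_univ _)
    have h4 := (Finset.sum_eq_zero_iff_of_nonneg (fun j _ => sq_nonneg _)).1 h3 j
      (Finset.mem_univ _)
    exact pow_eq_zero_iff two_ne_zero |>.1 h4
  have h3 : ∑ a, w a * inner ℝ (V a) u ^ 2 =
      ∑ i, ∑ j, u i * u j * ∑ a, w a * (V a i * V a j) := by
    simp only [Fin.sum_univ_three, Finset.mul_sum, ← Finset.sum_add_distrib]
    refine Finset.sum_congr rfl fun a _ => ?_
    rw [EuclideanSpace.real_inner_fin_three]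
    ring
  rw [h3]
  simp [h2]

/-- The degree bound gives a quadratic polynomial in ⟨x, z⟩ at points z only. Its linear term
vanishes because the cubic contraction does, and the resulting identity of quadratic forms extends
from points to all vectors. -/
theorem exists_sum_inner_sq_eq (h : S.IsSphericalModel V)
    (hl : ∀ x u, ∑ z, (inner ℝ (V x) (V z)) ^ 2 * inner ℝ (V z) u = 0) (i : Fin (d + 1)) :
    ∃ p c : ℝ, ∀ x u, ∑ y with S.rel x y = i, inner ℝ (V y) u ^ 2 =
      p * inner ℝ (V x) u ^ 2 + c * inner ℝ u u := by
  classical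
  obtain ⟨q, hq, hqe⟩ := h.poly i (Polynomial.X ^ 2) 2 (by simp)
  obtain ⟨a, b, c, hqq⟩ : ∃ a b c : ℝ, ∀ r, q.eval r = a * r ^ 2 + b * r + c := by
    refine ⟨q.coeff 2, q.coeff 1, q.coeff 0, fun r => ?_⟩
    rw [Polynomial.eval_eq_sum_range' (Nat.lt_succ_of_le hq)]
    simp [Finset.sum_range_succ]
    ring
  simp only [Polynomial.eval_pow, Polynomial.eval_X, hqq] at hqe
  obtain ⟨x₀, -⟩ := S.nonempty 0
  have hb : b = 0 := by
    have h1 : ∑ z, (∑ y with S.rel x₀ y = i, inner ℝ (V y) (V z) ^ 2) * inner ℝ (V z) (V x₀) =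
        ∑ z, (a * inner ℝ (V x₀) (V z) ^ 2 + b * inner ℝ (V x₀) (V z) + c) *
          inner ℝ (V z) (V x₀) := Finset.sum_congr rfl fun z _ => by rw [hqe]
    simp only [Finset.sum_mul, add_mul, Finset.sum_add_distrib, mul_assoc, ← Finset.mul_sum,
      h.sum_inner_eq_zero, real_inner_comm _ (V x₀)] at h1
    rw [Finset.sum_comm] at h1
    simp only [hl, Finset.sum_const_zero, h.moment, h.norm_one] at h1
    have h2 := h.card_pos
    have h4 := hl x₀ (V x₀)
    simp only [real_inner_comm _ (V x₀)] at h4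
    rw [h4] at h1
    have h3 : b * ((Fintype.card X : ℝ) / 3) = 0 := by linarith
    exact (mul_eq_zero.1 h3).resolve_right (by positivity)
  refine ⟨a, c, fun x u => ?_⟩
  -- The last term writes |u|² as (3/|X|) ∑ ⟨z, u⟩², so the whole difference is a combination of
  -- squares of the points.
  let w : X → ℝ := fun z => (if S.rel x z = i then 1 else 0) - (if z = x then a else 0) -
    c * (3 / Fintype.card X)
  have hw : ∀ u, ∑ z, w z * inner ℝ (V z) u ^ 2 =
      ∑ y with S.rel x y = i, inner ℝ (V y) u ^ 2 - a * inner ℝ (V x) u ^ 2 -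
        c * inner ℝ u u := fun u => by
    have h1 := h.moment u u
    simp only [w, sub_mul, Finset.sum_sub_distrib, Finset.sum_filter, ite_mul, one_mul, zero_mul]
    rw [Finset.sum_ite_eq' Finset.univ x, if_pos (Finset.mem_univ x), ← Finset.mul_sum]
    simp only [sq] at h1 ⊢
    rw [h1]
    have := h.card_pos
    field_simp
  have h1 := sum_mul_inner_sq_eq_zero (w := w) (fun z => by
    rw [hw, hqe, hb, h.norm_one]
    ring) u
  rw [hw] at h1
  linarith

/-- The neighbours of a point with respect to a relation form a design on a circle. -/
theorem exists_local_moments (h : S.IsSphericalModel V)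
    (hl : ∀ x u, ∑ z, (inner ℝ (V x) (V z)) ^ 2 * inner ℝ (V z) u = 0) {i : Fin (d + 1)} {t : ℝ}
    (hi : ∀ x y, S.rel x y = i → inner ℝ (V x) (V y) = t) :
    ∃ k : ℝ, ∀ x, ((univ.filter fun y => S.rel x y = i).card : ℝ) = k ∧ ∀ u,
      ∑ y with S.rel x y = i, inner ℝ (V y) u = k * t * inner ℝ (V x) u ∧
      ∑ y with S.rel x y = i, inner ℝ (V y) u ^ 2 =
        k * ((3 * t ^ 2 - 1) / 2 * inner ℝ (V x) u ^ 2 + (1 - t ^ 2) / 2 * inner ℝ u u) := by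
  obtain ⟨p, hp⟩ := h.exists_sum_inner_eq i
  obtain ⟨a, c, hac⟩ := h.exists_sum_inner_sq_eq hl i
  -- The trace of the quadratic identity. Taking u = `V x` below gives k t² = a + c, and the two
  -- equations determine a and c.
  have hk : ∀ x, ((univ.filter fun y => S.rel x y = i).card : ℝ) = a + 3 * c := fun x => by
    obtain ⟨b, -⟩ := EuclideanSpace.exists_orthonormalBasis_apply_zero (h.norm_one x)
    have h1 : ∑ j, ∑ y with S.rel x y = i, inner ℝ (V y) (b j) ^ 2 =
        ∑ j, (a * inner ℝ (V x) (b j) ^ 2 + c * inner ℝ (b j) (b j)) :=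
      Finset.sum_congr rfl fun j _ => hac x (b j)
    have h2 : ∀ y, ∑ j, inner ℝ (V y) (b j) ^ 2 = 1 := fun y => by
      rw [← h.norm_one y, ← b.sum_inner_mul_inner (V y) (V y)]
      exact Finset.sum_congr rfl fun j _ => by rw [real_inner_comm (V y) (b j), sq]
    have h3 : ∀ j, inner ℝ (b j) (b j) = (1 : ℝ) := fun j => by simp
    rw [Finset.sum_comm, Finset.sum_add_distrib, ← Finset.mul_sum] at h1
    simp only [h2, h3] at h1
    simp at h1
    linarith
  have hV : ∀ x y, S.rel x y = i → inner ℝ (V y) (V x) = t := fun x y hxy => by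
    rw [real_inner_comm, hi x y hxy]
  refine ⟨a + 3 * c, fun x => ⟨hk x, fun u => ?_⟩⟩
  have h1 := hp x (V x)
  have h2 := hac x (V x)
  rw [Finset.sum_congr rfl fun y hy => hV x y (Finset.mem_filter.1 hy).2] at h1
  rw [Finset.sum_congr rfl fun y hy => by rw [hV x y (Finset.mem_filter.1 hy).2]] at h2
  rw [Finset.sum_const, nsmul_eq_mul, hk, h.norm_one] at h1 h2
  rw [hp, hac]
  constructor
  · rw [h1, mul_one]
  · linear_combination (inner ℝ u u - 3 * inner ℝ (V x) u ^ 2) / 2 * h2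

end SymmetricAssociationScheme.IsSphericalModel

-- The nearest-point relation

namespace SymmetricAssociationScheme.IsSphericalModel

variable {X : Type*} [Fintype X] {d : ℕ} {S : SymmetricAssociationScheme X d} {V : X → 𝔼}

theorem inner_sq_le_one (h : S.IsSphericalModel V) (x y : X) : inner ℝ (V x) (V y) ^ 2 ≤ 1 := by
  have h1 := real_inner_mul_inner_self_le (V x) (V y)
  rw [h.norm_one, h.norm_one] at h1
  linarith

/-- The second moment |X|/3 is less than |X|, so some pair is neither equal nor antipodal, and the
maximum exceeds -1. -/
theorem exists_nearest (h : S.IsSphericalModel V) : ∃ x y, inner ℝ (V x) (V y) ^ 2 < 1 ∧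
    ∀ x' y', x' ≠ y' → inner ℝ (V x') (V y') ≤ inner ℝ (V x) (V y) := by
  classical
  obtain ⟨x₀, -⟩ := S.nonempty 0
  have hmom : ∀ x, ∑ y, inner ℝ (V y) (V x) ^ 2 = (Fintype.card X : ℝ) / 3 := fun x => by
    have := h.moment (V x) (V x)
    simpa only [← sq, h.norm_one, mul_one] using this
  have hn : ∀ x, ∃ y, inner ℝ (V y) (V x) ^ 2 < 1 := fun x => by
    by_contra hcon
    push Not at hcon
    have h1 : (Fintype.card X : ℝ) ≤ ∑ y, inner ℝ (V y) (V x) ^ 2 := by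
      have := Finset.card_nsmul_le_sum Finset.univ (fun y => inner ℝ (V y) (V x) ^ 2) 1
        fun y _ => hcon y
      simpa using this
    rw [hmom] at h1
    linarith [h.card_pos]
  obtain ⟨y₀, hy₀⟩ := hn x₀
  have hne : ∀ x y, inner ℝ (V x) (V y) ^ 2 < 1 → x ≠ y := by
    rintro x _ hxy rfl
    rw [h.norm_one] at hxy
    norm_num at hxy
  obtain ⟨⟨x, y⟩, hxy, hmax⟩ := Finset.exists_max_image
    (univ.filter fun q : X × X => q.1 ≠ q.2) (fun q => inner ℝ (V q.1) (V q.2))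
    ⟨(y₀, x₀), by simpa using hne _ _ hy₀⟩
  simp only [mem_filter, mem_univ, true_and, Prod.forall] at hxy hmax
  refine ⟨x, y, lt_of_le_of_ne (h.inner_sq_le_one x y) fun he => ?_, hmax⟩
  rcases sq_eq_sq_iff_eq_or_eq_neg.1 (he.trans (one_pow 2).symm) with e | e
  · exact hxy (h.inner_eq_one_iff.1 e)
  · have h1 := hmax y₀ x₀ (hne _ _ hy₀)
    rw [e] at h1
    nlinarith

/-- If the moments of degree three vanish, then the nearest points form a locally regular
configuration. -/
theorem exists_isNearestClosed (h : S.IsSphericalModel V)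
    (hl : ∀ x u, ∑ z, (inner ℝ (V x) (V z)) ^ 2 * inner ℝ (V z) u = 0) :
    ∃ t s : ℝ, t ^ 2 < 1 ∧ s ≤ t ∧ t ^ 2 - (1 - t ^ 2) / 2 ≤ s ∧
      IsNearestClosed (Set.range V) t s ∧
      ∀ x y z, inner ℝ (V x) (V y) = t → inner ℝ (V x) (V z) = t → y ≠ z →
        inner ℝ (V y) (V z) ≤ s := by
  classical
  obtain ⟨x₀, y₀, ht, hmax⟩ := h.exists_nearest
  obtain ⟨t, htdef⟩ : ∃ t, inner ℝ (V x₀) (V y₀) = t := ⟨_, rfl⟩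
  obtain ⟨i, hi⟩ : ∃ i, S.rel x₀ y₀ = i := ⟨_, rfl⟩
  rw [htdef] at ht hmax
  have hrel : ∀ x y, S.rel x y = i ↔ inner ℝ (V x) (V y) = t := fun x y => by
    rw [← hi, h.rel_iff, htdef]
  have ht0 : 0 < 1 - t ^ 2 := by linarith
  have hr0 : 0 < √(1 - t ^ 2) := Real.sqrt_pos.2 ht0
  have hr2 : √(1 - t ^ 2) ^ 2 = 1 - t ^ 2 := Real.sq_sqrt ht0.le
  obtain ⟨k, hk⟩ := h.exists_local_moments hl (fun x y hxy => (hrel x y).1 hxy)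
  -- The coordinates orthogonal to `V x`, rescaled to the unit circle, form a planar design by the
  -- local moments.
  have hplanar : ∀ x, ∃ α β : X → ℝ, IsPlanarDesign (univ.filter fun y => S.rel x y = i) α β ∧
      ∀ y z, S.rel x y = i → S.rel x z = i →
        inner ℝ (V y) (V z) = t ^ 2 + (1 - t ^ 2) * (α y * α z + β y * β z) := by
    intro x
    obtain ⟨b, hb⟩ := EuclideanSpace.exists_orthonormalBasis_apply_zero (h.norm_one x)
    have hbij : ∀ i j, inner ℝ (b i) (b j) = if i = j then (1 : ℝ) else 0 :=
      orthonormal_iff_ite.1 b.orthonormal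
    set r := √(1 - t ^ 2)
    have hin : ∀ y z, S.rel x y = i → S.rel x z = i → inner ℝ (V y) (V z) = t ^ 2 + (1 - t ^ 2) *
        (inner ℝ (V y) (b 1) / r * (inner ℝ (V z) (b 1) / r) +
          inner ℝ (V y) (b 2) / r * (inner ℝ (V z) (b 2) / r)) := by
      intro y z hy hz
      rw [← b.sum_inner_mul_inner, Fin.sum_univ_three, hb, real_inner_comm (V x) (V y),
        (hrel x y).1 hy, (hrel x z).1 hz, ← hr2, real_inner_comm (V z) (b 1),
        real_inner_comm (V z) (b 2)]
      field_simp
      ring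
    refine ⟨fun y => inner ℝ (V y) (b 1) / r, fun y => inner ℝ (V y) (b 2) / r,
      ⟨fun y hy => ?_, fun a c => ?_, fun a c => ?_⟩, hin⟩
    · have hy := (Finset.mem_filter.1 hy).2
      have h1 := hin y y hy hy
      rw [h.norm_one] at h1
      have h2 : (1 - t ^ 2) * ((inner ℝ (V y) (b 1) / r) ^ 2 + (inner ℝ (V y) (b 2) / r) ^ 2 - 1) = 0 := by
        linear_combination -h1
      linarith [(mul_eq_zero.1 h2).resolve_left ht0.ne']
    · have h1 := (hk x).2 (a • b 1 + c • b 2) |>.1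
      have h2 : ∀ y, inner ℝ (V y) (b 1) / r * a + inner ℝ (V y) (b 2) / r * c =
          inner ℝ (V y) (a • b 1 + c • b 2) / r := fun y => by
        rw [inner_add_right, inner_smul_right, inner_smul_right]
        ring
      simp only [h2]
      rw [← Finset.sum_div, h1, ← hb]
      simp [inner_add_right, inner_smul_right, hbij]
    · have h1 := (hk x).2 (a • b 1 + c • b 2) |>.2
      have h2 : ∀ y, (inner ℝ (V y) (b 1) / r * a + inner ℝ (V y) (b 2) / r * c) ^ 2 =
          inner ℝ (V y) (a • b 1 + c • b 2) ^ 2 / (1 - t ^ 2) := fun y => by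
        rw [inner_add_right, inner_smul_right, inner_smul_right, ← hr2]
        field_simp
      simp only [h2]
      rw [← Finset.sum_div, h1, ← hb, (hk x).1]
      simp only [inner_add_right, inner_add_left, inner_smul_right, inner_smul_left, hbij,
        RCLike.conj_to_real]
      simp
      field_simp
  have hne : ∀ x, (univ.filter fun y => S.rel x y = i).Nonempty := fun x => by
    rw [← Finset.card_pos, ← Nat.cast_pos (α := ℝ), (hk x).1, ← (hk x₀).1, Nat.cast_pos,
      Finset.card_pos]
    exact ⟨y₀, by simpa using hi⟩
  -- the largest inner product of two neighbours of a point
  obtain ⟨⟨x₁, y₁, z₁⟩, hxyz, hmax₁⟩ := Finset.exists_max_image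
    (univ.filter fun q : X × X × X => S.rel q.1 q.2.1 = i ∧ S.rel q.1 q.2.2 = i ∧ q.2.1 ≠ q.2.2)
    (fun q => inner ℝ (V q.2.1) (V q.2.2)) (by
      obtain ⟨α, β, hP, -⟩ := hplanar x₀
      have h3 := hP.three_le_card (hne x₀)
      obtain ⟨y, hy, z, hz, hyz⟩ := Finset.one_lt_card.1 (lt_of_lt_of_le (by norm_num) h3)
      exact ⟨(x₀, y, z), by simpa [hyz] using ⟨(mem_filter.1 hy).2, (mem_filter.1 hz).2⟩⟩)
  simp only [mem_filter, mem_univ, true_and, Prod.forall] at hxyz hmax₁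
  obtain ⟨s, hs⟩ : ∃ s, inner ℝ (V y₁) (V z₁) = s := ⟨_, rfl⟩
  obtain ⟨j, hj⟩ : ∃ j, S.rel z₁ y₁ = j := ⟨_, rfl⟩
  rw [hs] at hmax₁
  have hrelj : ∀ x y, S.rel x y = j ↔ inner ℝ (V x) (V y) = s := fun x y => by
    rw [← hj, h.rel_iff, ← hs, real_inner_comm (V z₁)]
  have hst : s ≤ t := hs ▸ hmax _ _ hxyz.2.2
  have hle : ∀ x y z, inner ℝ (V x) (V y) = t → inner ℝ (V x) (V z) = t → y ≠ z →
      inner ℝ (V y) (V z) ≤ s := fun x y z hy hz hyz =>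
    hmax₁ x y z ⟨(hrel x y).2 hy, (hrel x z).2 hz, hyz⟩
  -- C is the cosine, seen on the circle of neighbours, that corresponds to s.
  obtain ⟨C, hC⟩ : ∃ C, s = t ^ 2 + (1 - t ^ 2) * C := ⟨(s - t ^ 2) / (1 - t ^ 2), by field_simp; ring⟩
  have hbound : ∀ x (α β : X → ℝ), (∀ y z, S.rel x y = i → S.rel x z = i →
        inner ℝ (V y) (V z) = t ^ 2 + (1 - t ^ 2) * (α y * α z + β y * β z)) →
      ∀ y ∈ univ.filter (fun y => S.rel x y = i), ∀ z ∈ univ.filter (fun y => S.rel x y = i),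
        y ≠ z → α y * α z + β y * β z ≤ C := by
    intro x α β hin y hy z hz hyz
    have hy := (mem_filter.1 hy).2
    have hz := (mem_filter.1 hz).2
    have h1 := hmax₁ x y z ⟨hy, hz, hyz⟩
    rw [hin y z hy hz, hC] at h1
    exact le_of_mul_le_mul_left (by linarith) ht0
  obtain ⟨p, hp⟩ := S.intersection i j i
  refine ⟨t, s, ht, hst, ?_, ⟨?_, ?_, ⟨V x₀, ⟨x₀, rfl⟩, V y₀, ⟨y₀, rfl⟩, htdef⟩, ?_⟩, hle⟩
  · obtain ⟨α, β, hP, hin⟩ := hplanar x₀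
    have h1 := hP.neg_half_le (hne x₀) (hbound x₀ α β hin)
    rw [hC]
    nlinarith
  · rintro _ ⟨x, rfl⟩
    exact h.norm_one x
  · rintro _ ⟨x, rfl⟩ _ ⟨y, rfl⟩ hxy
    exact hmax x y fun e => hxy (e ▸ rfl)
  -- The triple attaining s shows p ≥ 1. If p = 1, each neighbour of x₀ has exactly one nearest
  -- neighbour on the circle, which a planar design with C < 1/2 forbids; that bound comes from s ≤
  -- t < 1.
  · have hp2 : 2 ≤ p := by
      have hp1 : 1 ≤ p := by
        rw [← hp x₁ y₁ hxyz.1]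
        exact Finset.card_pos.2 ⟨z₁, by simpa [hj] using hxyz.2.1⟩
      by_contra hlt
      obtain rfl : p = 1 := by omega
      obtain ⟨α, β, hP, hin⟩ := hplanar x₀
      refine hP.not_forall_existsUnique (hne x₀) (hbound x₀ α β hin) ?_ fun y hy => ?_
      · by_contra hC2
        push Not at hC2
        have : t < 1 := by nlinarith
        nlinarith
      · obtain ⟨z, hz⟩ := Finset.card_eq_one.1 (hp x₀ y (mem_filter.1 hy).2)
        have hy := (mem_filter.1 hy).2
        have hiff : ∀ w, (S.rel x₀ w = i ∧ S.rel w y = j) ↔ w = z := fun w => by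
          have := Finset.ext_iff.1 hz w
          simpa using this
        have hC' : ∀ w, S.rel x₀ w = i → (α y * α w + β y * β w = C ↔ S.rel w y = j) := by
          intro w hw
          rw [hrelj, real_inner_comm, hin y w hy hw, hC, add_right_inj,
            mul_right_inj' ht0.ne']
        obtain ⟨hz1, hz2⟩ := (hiff z).2 rfl
        refine ⟨z, ⟨by simpa using hz1, (hC' z hz1).2 hz2⟩, ?_⟩
        rintro w ⟨hw1, hw2⟩
        have hw1 := (mem_filter.1 hw1).2
        exact (hiff w).1 ⟨hw1, (hC' w hw1).1 hw2⟩
    rintro _ ⟨x, rfl⟩ _ ⟨y, rfl⟩ hxy z hz hxz hyz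
    have hc := hp x y ((hrel x y).2 hxy)
    obtain ⟨z₂, h₂, z₃, h₃, h₂₃⟩ := Finset.one_lt_card.1 (lt_of_lt_of_le (by omega) hc.ge)
    simp only [mem_filter, mem_univ, true_and, hrel, hrelj] at h₂ h₃
    rcases EuclideanSpace.eq_or_eq_of_inner_eq (h.norm_one x) (h.norm_one y) hxy ht hz
      (h.norm_one z₂) (h.norm_one z₃) hxz h₂.1 h₃.1 hyz ((real_inner_comm _ _).trans h₂.2)
      ((real_inner_comm _ _).trans h₃.2) (h.injective.ne h₂₃) with e | e
    · exact ⟨z₂, e.symm⟩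
    · exact ⟨z₃, e.symm⟩

end SymmetricAssociationScheme.IsSphericalModel

-- Exclusion of the dodecahedron

namespace SymmetricAssociationScheme.IsSphericalModel

variable {X : Type*} [Fintype X] {d : ℕ} {S : SymmetricAssociationScheme X d} {V : X → 𝔼}

/-- The vertices of the regular dodecahedron are not the spherical embedding of a Q-polynomial
scheme, because the sum of the third powers of the inner products with the neighbours of a vertex is
not a cubic polynomial in the inner product with this vertex. -/
theorem not_isNearestClosed_dodecahedron (h : S.IsSphericalModel V)
    (hle : ∀ x y z, inner ℝ (V x) (V y) = √5 / 3 → inner ℝ (V x) (V z) = √5 / 3 → y ≠ z →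
      inner ℝ (V y) (V z) ≤ 1 / 3) : ¬ IsNearestClosed (Set.range V) (√5 / 3) (1 / 3) := by
  classical
  intro hY
  have hφ5 : √5 = 2 * Real.goldenRatio - 1 := by unfold Real.goldenRatio; ring
  have hφ := Real.goldenRatio_sq
  have hφ0 := Real.goldenRatio_pos
  rw [hφ5] at hY hle
  generalize Real.goldenRatio = φ at *
  have ht : (3 : ℝ) * ((2 * φ - 1) / 3) = 2 * φ - 1 := by ring
  have hs : (3 : ℝ) * (1 / 3) = 1 := by norm_num
  obtain ⟨R, -, hx, hy₂, hcl⟩ := hY.exists_scaled_preimage_mem (by nlinarith) (N := 3)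
    (a := !₂[1, 1, 1]) (b := !₂[φ - 1, φ, 0]) (by norm_num)
    (by rw [inner_mk_mk]; norm_num) (by rw [inner_mk_mk]; linear_combination 2 * hφ)
    (by rw [inner_mk_mk]; ring)
  rw [ht, hs] at hcl
  have hD := fun {a b c a' b' c' a'' b'' c''} =>
    mem_of_coordinates hcl (a := a) (b := b) (c := c) (a' := a') (b' := b') (c' := c')
      (a'' := a'') (b'' := b'') (c'' := c'')
  have hy₁ := hD (a'' := 0) (b'' := φ - 1) (c'' := φ) hx hy₂ (by linarith) (by linarith)
    (by linarith) (by linarith)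
  have hy₃ := hD (a'' := φ) (b'' := 0) (c'' := φ - 1) hx hy₂ (by linarith) (by linarith)
    (by linarith) (by linarith)
  have hw := hD (a'' := 1) (b'' := 1) (c'' := -1) hy₂ hx (by linarith) (by linarith)
    (by linarith) (by linarith)
  have hv := hD (a'' := 0) (b'' := φ - 1) (c'' := -φ) hw hy₂ (by linarith) (by linarith)
    (by linarith) (by linarith)
  have hy₁' := hD (a'' := 0) (b'' := -(φ - 1)) (c'' := -φ) hv hw (by linarith) (by linarith)
    (by linarith) (by linarith)
  have hx' := hD (a'' := -1) (b'' := -1) (c'' := -1) hy₁' hv (by linarith) (by linarith)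
    (by linarith) (by linarith)
  have hy₂' := hD (a'' := -(φ - 1)) (b'' := -φ) (c'' := 0) hx' hy₁' (by linarith) (by linarith)
    (by linarith) (by linarith)
  have hw' := hD (a'' := -1) (b'' := -1) (c'' := 1) hy₂' hx' (by linarith) (by linarith)
    (by linarith) (by linarith)
  clear hD hcl hv hy₂'
  obtain ⟨x, ex⟩ := hx
  obtain ⟨x', ex'⟩ := hx'
  obtain ⟨y₁, ey₁⟩ := hy₁
  obtain ⟨y₁', ey₁'⟩ := hy₁'
  obtain ⟨y₂, ey₂⟩ := hy₂
  obtain ⟨y₃, ey₃⟩ := hy₃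
  obtain ⟨w, ew⟩ := hw
  obtain ⟨w', ew'⟩ := hw'
  have hin : ∀ {u v : X} {a b c a' b' c' : ℝ}, V u = R ((√3)⁻¹ • !₂[a, b, c]) →
      V v = R ((√3)⁻¹ • !₂[a', b', c']) → ∀ r : ℝ, a * a' + b * b' + c * c' = 3 * r →
      inner ℝ (V u) (V v) = r := fun eu ev r hr => by
    rw [eu, ev, R.inner_map_map, inner_smul_sqrt_inv (by norm_num), inner_mk_mk, hr]
    ring
  have hne : ∀ {u v : X} {r : ℝ}, inner ℝ (V u) (V v) = r → r ≠ 1 → u ≠ v := by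
    rintro u _ r hr h1 rfl
    exact h1 (hr ▸ h.norm_one u)
  have h12 := hne (hin ey₁ ey₂ (1 / 3) (by linarith)) (by norm_num)
  have h13 := hne (hin ey₁ ey₃ (1 / 3) (by linarith)) (by norm_num)
  have h23 := hne (hin ey₂ ey₃ (1 / 3) (by linarith)) (by norm_num)
  obtain ⟨i, hi⟩ : ∃ i, S.rel x y₁ = i := ⟨_, rfl⟩
  have hrel : ∀ y, S.rel x y = i ↔ inner ℝ (V x) (V y) = (2 * φ - 1) / 3 := fun y => by
    rw [← hi, h.rel_iff, hin ex ey₁ ((2 * φ - 1) / 3) (by ring)]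
  have hnbr : (univ.filter fun y => S.rel x y = i) = {y₁, y₂, y₃} := by
    ext z
    simp only [mem_filter, mem_univ, true_and, mem_insert, mem_singleton, hrel]
    constructor
    · intro hz
      by_contra hcon
      push Not at hcon
      -- A fourth neighbour z would have inner products with these three summing to 5/3, whereas
      -- each is at most 1/3.
      have h1 : V y₁ + V y₂ + V y₃ = (2 * φ - 1) • V x := by
        rw [ex, ey₁, ey₂, ey₃, ← map_add, ← map_add, ← map_smul, ← smul_add, ← smul_add, smul_comm]
        congr 2
        ext j
        fin_cases j <;> simp <;> ring
      have h2 := congrArg (fun v => inner ℝ v (V z)) h1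
      simp only [inner_add_left, inner_smul_left, RCLike.conj_to_real, hz] at h2
      have g1 := hle x y₁ z (hin ex ey₁ _ (by ring)) hz (Ne.symm hcon.1)
      have g2 := hle x y₂ z (hin ex ey₂ _ (by ring)) hz (Ne.symm hcon.2.1)
      have g3 := hle x y₃ z (hin ex ey₃ _ (by ring)) hz (Ne.symm hcon.2.2)
      nlinarith
    · rintro (rfl | rfl | rfl)
      · exact hin ex ey₁ _ (by ring)
      · exact hin ex ey₂ _ (by ring)
      · exact hin ex ey₃ _ (by ring)
  obtain ⟨q, hq, hqe⟩ := h.poly i (Polynomial.X ^ 3) 3 (by simp)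
  obtain ⟨a, b, c, e, hqq⟩ : ∃ a b c e : ℝ, ∀ r, q.eval r = a * r ^ 3 + b * r ^ 2 + c * r + e := by
    refine ⟨q.coeff 3, q.coeff 2, q.coeff 1, q.coeff 0, fun r => ?_⟩
    rw [Polynomial.eval_eq_sum_range' (Nat.lt_succ_of_le hq)]
    simp [Finset.sum_range_succ]
    ring
  have hcub : ∀ z, inner ℝ (V y₁) (V z) ^ 3 + inner ℝ (V y₂) (V z) ^ 3 + inner ℝ (V y₃) (V z) ^ 3 =
      a * inner ℝ (V x) (V z) ^ 3 + b * inner ℝ (V x) (V z) ^ 2 + c * inner ℝ (V x) (V z) + e := by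
    intro z
    rw [← hqq, ← hqe, hnbr, Finset.sum_insert, Finset.sum_insert, Finset.sum_singleton]
    · simp only [Polynomial.eval_pow, Polynomial.eval_X]
      ring
    · simpa using h23
    · simpa using ⟨h12, h13⟩
  -- Subtracting the equations for antipodal points leaves the odd part a r³ + c r. The pairs at x
  -- and w give a = 0 and c = 5r/3; the pair at y₁ then demands 29/27 = 25/27.
  have c1 := hcub x
  have c2 := hcub x'
  have c3 := hcub y₁
  have c4 := hcub y₁'
  have c5 := hcub w
  have c6 := hcub w'
  obtain ⟨r, hr⟩ : ∃ r, r = (2 * φ - 1) / 3 := ⟨_, rfl⟩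
  have hr2 : r ^ 2 = 5 / 9 := by rw [hr]; linear_combination 4 / 9 * hφ
  rw [hin ey₁ ex r (by linarith), hin ey₂ ex r (by linarith), hin ey₃ ex r (by linarith),
    h.norm_one] at c1
  rw [hin ey₁ ex' (-r) (by linarith), hin ey₂ ex' (-r) (by linarith),
    hin ey₃ ex' (-r) (by linarith), hin ex ex' (-1) (by linarith)] at c2
  rw [h.norm_one, hin ey₂ ey₁ (1 / 3) (by linarith), hin ey₃ ey₁ (1 / 3) (by linarith),
    hin ex ey₁ r (by linarith)] at c3
  rw [hin ey₁ ey₁' (-1) (by linarith), hin ey₂ ey₁' (-1 / 3) (by linarith),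
    hin ey₃ ey₁' (-1 / 3) (by linarith), hin ex ey₁' (-r) (by linarith)] at c4
  rw [hin ey₁ ew (-1 / 3) (by linarith), hin ey₂ ew r (by linarith),
    hin ey₃ ew (1 / 3) (by linarith), hin ex ew (1 / 3) (by linarith)] at c5
  rw [hin ey₁ ew' (1 / 3) (by linarith), hin ey₂ ew' (-r) (by linarith),
    hin ey₃ ew' (-1 / 3) (by linarith), hin ex ew' (-1 / 3) (by linarith)] at c6
  have d1 : 5 / 3 * r = a + c := by linear_combination (c1 - c2) / 2 - 3 * r * hr2
  have d2 : 29 / 27 = 5 / 9 * a * r + c * r := by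
    linear_combination (c3 - c4) / 2 + a * r * hr2
  have d3 : 5 / 9 * r = a / 27 + c / 3 := by linear_combination (c5 - c6) / 2 - r * hr2
  have d4 : a = 0 := by linarith
  have d5 : c = 5 / 3 * r := by linarith
  rw [d4, d5] at d2
  nlinarith

end SymmetricAssociationScheme.IsSphericalModel

-- The classification

namespace SymmetricAssociationScheme

variable {X : Type*} [Fintype X] {d : ℕ} {S : SymmetricAssociationScheme X d} {V : X → 𝔼}

/-- The zero sum forces |X| = 4. For distinct x and y the other two points already fill both
positions that the closure condition allows. -/
theorem IsSphericalModel.isNearestClosed_tetrahedron (h : S.IsSphericalModel V)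
    (hV : ∀ x y, x ≠ y → inner ℝ (V x) (V y) = -1 / 3) :
    IsNearestClosed (Set.range V) (-1 / 3) (-1 / 3) := by
  classical
  obtain ⟨x₀, y₀, hxy₀, -⟩ := h.exists_nearest
  have hne : x₀ ≠ y₀ := by
    rintro rfl
    rw [h.norm_one] at hxy₀
    norm_num at hxy₀
  have hcard : Fintype.card X = 4 := by
    have h1 := h.sum_inner_eq_zero (V x₀)
    rw [← Finset.add_sum_erase _ _ (mem_univ x₀), h.norm_one,
      Finset.sum_congr rfl fun y hy => hV y x₀ (Finset.ne_of_mem_erase hy), Finset.sum_const,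
      nsmul_eq_mul] at h1
    have h2 := Finset.card_erase_add_one (mem_univ x₀)
    rw [Finset.card_univ] at h2
    have h3 : ((univ.erase x₀).card : ℝ) = 3 := by linarith
    have h4 : (univ.erase x₀).card = 3 := by exact_mod_cast h3
    omega
  refine ⟨?_, ?_, ⟨V x₀, ⟨x₀, rfl⟩, V y₀, ⟨y₀, rfl⟩, hV _ _ hne⟩, ?_⟩
  · rintro _ ⟨x, rfl⟩
    exact h.norm_one x
  · rintro _ ⟨x, rfl⟩ _ ⟨y, rfl⟩ hxy
    exact (hV x y fun e => hxy (e ▸ rfl)).le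
  · rintro _ ⟨x, rfl⟩ _ ⟨y, rfl⟩ hxy z hz hxz hyz
    have hxy' : x ≠ y := by
      rintro rfl
      rw [h.norm_one] at hxy
      norm_num at hxy
    have h2 : ((univ.erase x).erase y).card = 2 := by
      rw [Finset.card_erase_of_mem (Finset.mem_erase.2 ⟨hxy'.symm, mem_univ y⟩),
        Finset.card_erase_of_mem (mem_univ x), Finset.card_univ, hcard]
    obtain ⟨u, hu, v, hv, huv⟩ := Finset.one_lt_card.1 (h2 ▸ one_lt_two)
    simp only [Finset.mem_erase, mem_univ, and_true] at hu hv
    rcases EuclideanSpace.eq_or_eq_of_inner_eq (h.norm_one x) (h.norm_one y) hxy (by norm_num) hz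
      (h.norm_one u) (h.norm_one v) hxz (hV _ _ hu.2.symm) (hV _ _ hv.2.symm) hyz
      (hV _ _ hu.1.symm) (hV _ _ hv.1.symm) (h.injective.ne huv) with e | e
    · exact ⟨u, e.symm⟩
    · exact ⟨v, e.symm⟩

theorem IsSphericalModel.exists_polyhedron (h : S.IsSphericalModel V) :
    ∃ (P : SchemePolyhedron) (t : ℝ),
      (P = .tetrahedron ∧ t = -1 / 3 ∨ P = .octahedron ∧ t = 0 ∨ P = .cube ∧ t = 1 / 3 ∨
        P = .icosahedron ∧ t = √5 / 5) ∧
      (∃ R : 𝔼 ≃ₗᵢ[ℝ] 𝔼, R '' P.vertices = Set.range V) ∧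
      IsGreatest {r | ∃ x y, x ≠ y ∧ inner ℝ (V x) (V y) = r} t := by
  suffices hsuff : ∃ t s, (t = -1 / 3 ∧ s = -1 / 3 ∨ t = 0 ∧ s = 0 ∨ t = 1 / 3 ∧ s = -1 / 3 ∨
      t = √5 / 5 ∧ s = √5 / 5) ∧ IsNearestClosed (Set.range V) t s by
    obtain ⟨t, s, hts, hY⟩ := hsuff
    have hgr : t ≠ 1 → IsGreatest {r | ∃ x y, x ≠ y ∧ inner ℝ (V x) (V y) = r} t := by
      intro ht
      constructor
      · obtain ⟨_, ⟨x, rfl⟩, _, ⟨y, rfl⟩, hxy⟩ := hY.attained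
        refine ⟨x, y, ?_, hxy⟩
        rintro rfl
        exact ht (hxy ▸ h.norm_one x)
      · rintro _ ⟨x, y, hxy, rfl⟩
        exact hY.le _ ⟨x, rfl⟩ _ ⟨y, rfl⟩ (h.injective.ne hxy)
    rcases hts with ⟨rfl, rfl⟩ | ⟨rfl, rfl⟩ | ⟨rfl, rfl⟩ | ⟨rfl, rfl⟩
    · exact ⟨_, _, by simp, hY.exists_tetrahedron, hgr (by norm_num)⟩
    · exact ⟨_, _, by simp, hY.exists_octahedron, hgr (by norm_num)⟩
    · exact ⟨_, _, by simp, hY.exists_cube, hgr (by norm_num)⟩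
    · refine ⟨_, _, by simp, hY.exists_icosahedron, hgr fun h5 => ?_⟩
      have : √(5 : ℝ) ^ 2 = 5 := Real.sq_sqrt (by norm_num)
      nlinarith
  obtain ⟨l, hl⟩ := h.cubic
  by_cases hl0 : l = 0
  · subst hl0
    simp only [zero_mul] at hl
    obtain ⟨t, s, ht, hst, hs, hY, hle⟩ := h.exists_isNearestClosed hl
    refine ⟨t, s, ?_, hY⟩
    rcases hY.cases ht hst hs (by
      rintro _ ⟨x, rfl⟩ _ ⟨y, rfl⟩ _ ⟨z, rfl⟩ hxy hxz hyz
      exact hle x y z hxy hxz fun e => hyz (e ▸ rfl)) with e | e | e | ⟨rfl, rfl⟩ | e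
    · exact Or.inl e
    · exact Or.inr (Or.inl e)
    · exact Or.inr (Or.inr (Or.inl e))
    · exact absurd hY (h.not_isNearestClosed_dodecahedron hle)
    · exact Or.inr (Or.inr (Or.inr e))
  · exact ⟨_, _, Or.inl ⟨rfl, rfl⟩, h.isNearestClosed_tetrahedron fun x y hxy =>
      h.inner_eq_of_cubic_ne_zero hl0 hl hxy⟩

theorem IsQPolynomial.inner_sphericalEmbedding_eq [DecidableEq X]
    {E : Fin (d + 1) → Matrix X X ℝ} (h : S.IsQPolynomial E) (h3 : (E 1).rank = 3) (x y : X) :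
    inner ℝ (sphericalEmbedding (E 1) x) (sphericalEmbedding (E 1) y) =
      (Fintype.card X : ℝ) / 3 * E 1 x y := by
  rw [inner_sphericalEmbedding (h.idempotents.idem 1) (S.symm_of_mem (h.idempotents.mem 1)), h3]
  norm_num

/-- A Q-polynomial scheme of multiplicity three is realized by one of four polyhedra, which is
determined by the largest inner product of different points. -/
theorem IsQPolynomial.exists_isRealizedBy [DecidableEq X]
    {E : Fin (d + 1) → Matrix X X ℝ} (h : S.IsQPolynomial E) (h3 : (E 1).rank = 3) :
    ∃ (P : SchemePolyhedron) (t : ℝ),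
      (P = .tetrahedron ∧ t = -1 / 3 ∨ P = .octahedron ∧ t = 0 ∨ P = .cube ∧ t = 1 / 3 ∨
        P = .icosahedron ∧ t = √5 / 5) ∧ S.IsRealizedBy (E 1) P ∧
      IsGreatest {r | ∃ x y, x ≠ y ∧ (Fintype.card X : ℝ) / 3 * E 1 x y = r} t := by
  obtain ⟨V, L, hL⟩ := exists_coordinates_sphericalEmbedding h3
  have hV : ∀ x y, inner ℝ (V x) (V y) = (Fintype.card X : ℝ) / 3 * E 1 x y := fun x y => by
    rw [← L.inner_map_map, hL, hL, h.inner_sphericalEmbedding_eq h3]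
  have hm := h.isSphericalModel h3 hV
  obtain ⟨P, t, hPt, ⟨R, hR⟩, ht⟩ := hm.exists_polyhedron
  simp only [hV] at ht
  refine ⟨P, t, hPt, ⟨?_, ⟨L.comp R.toLinearIsometry, ?_⟩, ?_⟩, ht⟩
  · intro x y hxy
    rw [← hL, ← hL] at hxy
    exact hm.injective (L.injective hxy)
  · rw [LinearIsometry.coe_comp, Set.image_comp, LinearIsometryEquiv.coe_toLinearIsometry, hR,
      ← Set.range_comp]
    exact congrArg Set.range (funext hL)
  · intro x y x' y'
    rw [hm.rel_iff, ← hL, ← hL, ← hL, ← hL, L.inner_map_map, L.inner_map_map]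

end SymmetricAssociationScheme

end

-- The converse: explicit schemes

section

open Finset

/-- The data of a symmetric association scheme on `Fin n`, given by its intersection numbers, and of
its dual eigenmatrix. -/
structure SchemeTable (n d : ℕ) where
  rel : Fin n → Fin n → Fin (d + 1)
  inter : Fin (d + 1) → Fin (d + 1) → Fin (d + 1) → ℕ
  dual : Fin (d + 1) → Fin (d + 1) → ℝ
  nonempty : ∀ i, ∃ x y, rel x y = i
  diag : ∀ x y, rel x y = 0 ↔ x = y
  symm : ∀ x y, rel x y = rel y x
  card_eq : ∀ i j x y,
    (Finset.univ.filter fun z => rel x z = i ∧ rel z y = j).card = inter i j (rel x y)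
  dual_zero : ∀ k, dual 0 k = 1
  dual_ne_zero : ∀ i, dual i 0 ≠ 0
  sum_dual : ∀ k, ∑ i, dual i k = if k = 0 then (n : ℝ) else 0
  -- The relations E_i E_j = δ_ij E_i, expanded in adjacency matrices.
  sum_inter : ∀ i j k, ∑ a, ∑ b, dual i a * dual j b * inter a b k =
    if i = j then n * dual i k else 0
  poly : ∀ i : Fin (d + 1), ∃ v : Polynomial ℝ, v.degree = ((i : ℕ) : WithBot ℕ) ∧
    ∀ k, v.eval (dual 1 k) = dual i k

namespace SchemeTable

variable {n d : ℕ} (T : SchemeTable n d)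

/-- The association scheme of a table. -/
def scheme : SymmetricAssociationScheme (Fin n) d where
  rel := T.rel
  nonempty := T.nonempty
  diag := T.diag
  symm := T.symm
  intersection i j k := ⟨T.inter i j k, fun x y hxy => by rw [T.card_eq, hxy]⟩

/-- The primitive idempotents of a table. -/
noncomputable def idempotent (i : Fin (d + 1)) : Matrix (Fin n) (Fin n) ℝ :=
  Matrix.of fun x y => T.dual i (T.rel x y) / n

theorem cast_ne_zero {n d : ℕ} (T : SchemeTable n d) : (n : ℝ) ≠ 0 := by
  obtain ⟨x, -⟩ := T.nonempty 0
  have := x.pos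
  positivity

theorem idempotent_mul (i j : Fin (d + 1)) :
    T.idempotent i * T.idempotent j = if i = j then T.idempotent i else 0 := by
  have hn := T.cast_ne_zero
  ext x y
  have h1 : (T.idempotent i * T.idempotent j) x y =
      (∑ a, ∑ b, T.dual i a * T.dual j b * T.inter a b (T.rel x y)) / n ^ 2 := by
    rw [Matrix.mul_apply, Finset.sum_div]
    have h2 : ∀ z, T.idempotent i x z * T.idempotent j z y = ∑ a, ∑ b,
        if T.rel x z = a ∧ T.rel z y = b then T.dual i a * T.dual j b / n ^ 2 else 0 := by
      intro z
      simp only [ite_and, Finset.sum_ite_irrel, Finset.sum_ite_eq, Finset.mem_univ, if_true,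
        Finset.sum_const_zero]
      simp only [idempotent, Matrix.of_apply]
      field_simp
    simp only [h2]
    rw [Finset.sum_comm]
    refine Finset.sum_congr rfl fun a _ => ?_
    rw [Finset.sum_comm, Finset.sum_div]
    refine Finset.sum_congr rfl fun b _ => ?_
    rw [← T.card_eq, ← Finset.sum_filter, Finset.sum_const, nsmul_eq_mul]
    ring
  rw [h1, T.sum_inter]
  split_ifs with hij
  · simp only [idempotent, Matrix.of_apply]
    field_simp
  · simp

theorem isPrimitiveIdempotents : T.scheme.IsPrimitiveIdempotents T.idempotent where
  mem i := T.scheme.of_rel_mem_boseMesner fun k => T.dual i k / n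
  ne_zero i h := by
    obtain ⟨x, -⟩ := T.nonempty 0
    have h1 := congrFun (congrFun h x) x
    simp only [idempotent, Matrix.of_apply, (T.diag x x).2 rfl, Matrix.zero_apply] at h1
    exact div_ne_zero (T.dual_ne_zero i) T.cast_ne_zero h1
  idem i := by rw [T.idempotent_mul, if_pos rfl]
  orthogonal i j hij := by rw [T.idempotent_mul, if_neg hij]
  sum_eq_one := by
    ext x y
    simp only [Matrix.sum_apply, idempotent, Matrix.of_apply, ← Finset.sum_div, T.sum_dual, T.diag,
      Matrix.one_apply]
    split_ifs
    · exact div_self T.cast_ne_zero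
    · simp
  zero_eq := by
    ext x y
    simp [idempotent, T.dual_zero]

theorem isQPolynomial : T.scheme.IsQPolynomial T.idempotent where
  idempotents := T.isPrimitiveIdempotents
  polynomial i := by
    obtain ⟨v, hv, he⟩ := T.poly i
    refine ⟨v, hv, fun x y => ?_⟩
    simp only [idempotent, Matrix.of_apply, Fintype.card_fin, mul_div_cancel₀ _ T.cast_ne_zero, he]

theorem rank_idempotent_one (h : T.dual 1 0 = 3) : (T.idempotent 1).rank = 3 := by
  have h1 : (T.idempotent 1).trace = 3 := by
    simp only [Matrix.trace, Matrix.diag_apply, idempotent, Matrix.of_apply, (T.diag _ _).2, h,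
      Finset.sum_const, Finset.card_univ, Fintype.card_fin, nsmul_eq_mul,
      mul_div_cancel₀ _ T.cast_ne_zero]
  rw [Matrix.trace_eq_rank_of_isIdempotentElem (T.isPrimitiveIdempotents.idem 1)] at h1
  exact_mod_cast h1

/-- No coordinates are matched: the classification realizes the scheme by one of the four polyhedra,
and the four values of t are distinct, so the largest inner product in the table identifies it. -/
theorem exists_realization (h : T.dual 1 0 = 3) {P : SchemePolyhedron} {t : ℝ}
    (hPt : P = .tetrahedron ∧ t = -1 / 3 ∨ P = .octahedron ∧ t = 0 ∨ P = .cube ∧ t = 1 / 3 ∨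
        P = .icosahedron ∧ t = √5 / 5)
    (hle : ∀ k, k ≠ 0 → T.dual 1 k / 3 ≤ t) (heq : ∃ k, k ≠ 0 ∧ T.dual 1 k / 3 = t) :
    ∃ (n d : ℕ) (S : SymmetricAssociationScheme (Fin n) d)
      (E : Fin (d + 1) → Matrix (Fin n) (Fin n) ℝ),
      S.IsQPolynomial E ∧ (E 1).rank = 3 ∧ S.IsRealizedBy (E 1) P := by
  refine ⟨n, d, T.scheme, T.idempotent, T.isQPolynomial, T.rank_idempotent_one h, ?_⟩
  obtain ⟨P', t', hPt', hP', ht'⟩ := T.isQPolynomial.exists_isRealizedBy (T.rank_idempotent_one h)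
  have hval : ∀ x y, (Fintype.card (Fin n) : ℝ) / 3 * T.idempotent 1 x y =
      T.dual 1 (T.rel x y) / 3 := fun x y => by
    have := T.cast_ne_zero
    simp only [idempotent, Matrix.of_apply, Fintype.card_fin]
    field_simp
  simp only [hval] at ht'
  have ht : IsGreatest {r | ∃ x y, x ≠ y ∧ T.dual 1 (T.rel x y) / 3 = r} t := by
    constructor
    · obtain ⟨k, hk, hkt⟩ := heq
      obtain ⟨x, y, rfl⟩ := T.nonempty k
      exact ⟨x, y, fun hxy => hk ((T.diag x y).2 hxy), hkt⟩
    · rintro _ ⟨x, y, hxy, rfl⟩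
      exact hle _ fun h0 => hxy ((T.diag x y).1 h0)
  have htt := ht.unique ht'
  have h5 : √(5 : ℝ) ^ 2 = 5 := Real.sq_sqrt (by norm_num)
  have h50 : 0 ≤ √(5 : ℝ) := Real.sqrt_nonneg 5
  have : P = P' := by
    rcases hPt with ⟨rfl, rfl⟩ | ⟨rfl, rfl⟩ | ⟨rfl, rfl⟩ | ⟨rfl, rfl⟩ <;>
      rcases hPt' with ⟨rfl, rfl⟩ | ⟨rfl, rfl⟩ | ⟨rfl, rfl⟩ | ⟨rfl, rfl⟩ <;>
      first | rfl | (exfalso; nlinarith)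
  exact this ▸ hP'

/-- The scheme of the regular tetrahedron. -/
noncomputable def tetrahedron : SchemeTable 4 1 where
  rel x y := if x = y then 0 else 1
  inter := ![![![1, 0], ![0, 1]], ![![0, 1], ![3, 2]]]
  dual := ![![1, 1], ![3, -1]]
  nonempty := by decide
  diag := by decide
  symm := by decide
  card_eq := by decide
  dual_zero k := by fin_cases k <;> rfl
  dual_ne_zero i := by fin_cases i <;> norm_num
  sum_dual k := by fin_cases k <;> norm_num [Fin.sum_univ_succ]
  sum_inter i j k := by
    fin_cases i <;> fin_cases j <;> fin_cases k <;> norm_num [Fin.sum_univ_succ]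
  poly i := by
    fin_cases i
    · exact ⟨1, by simp, fun k => by fin_cases k <;> simp⟩
    · exact ⟨Polynomial.X, by simp, fun k => by simp⟩

/-- The scheme of the regular octahedron; antipodal vertices have the same residue modulo three. -/
noncomputable def octahedron : SchemeTable 6 2 where
  rel x y := if x = y then 0 else if x.val % 3 = y.val % 3 then 2 else 1
  inter := ![![![1, 0, 0], ![0, 1, 0], ![0, 0, 1]], ![![0, 1, 0], ![4, 2, 4], ![0, 1, 0]],
    ![![0, 0, 1], ![0, 1, 0], ![1, 0, 0]]]
  dual := ![![1, 1, 1], ![3, 0, -3], ![2, -1, 2]]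
  nonempty := by decide
  diag := by decide
  symm := by decide
  card_eq := by decide +kernel
  dual_zero k := by fin_cases k <;> rfl
  dual_ne_zero i := by fin_cases i <;> norm_num
  sum_dual k := by fin_cases k <;> norm_num [Fin.sum_univ_succ]
  sum_inter i j k := by
    fin_cases i <;> fin_cases j <;> fin_cases k <;> norm_num [Fin.sum_univ_succ]
  poly i := by
    fin_cases i
    · exact ⟨1, by simp, fun k => by fin_cases k <;> simp⟩
    · exact ⟨Polynomial.X, by simp, fun k => by simp⟩
    -- Interpolates row 2 of the dual matrix at the values in row 1; zero coefficients are kept to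
    -- fit `Polynomial.degree_quadratic`.
    · exact ⟨Polynomial.C (1 / 3) * Polynomial.X ^ 2 + Polynomial.C 0 * Polynomial.X +
        Polynomial.C (-1), Polynomial.degree_quadratic (by norm_num),
        fun k => by fin_cases k <;> norm_num⟩

set_option maxHeartbeats 2000000 in
/-- The scheme of the cube: the Hamming scheme on the binary words of length three. -/
noncomputable def cube : SchemeTable 8 3 where
  rel x y := (if x.val / 4 = y.val / 4 then 0 else 1) +
    (if x.val / 2 % 2 = y.val / 2 % 2 then 0 else 1) + (if x.val % 2 = y.val % 2 then 0 else 1)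
  inter := ![![![1, 0, 0, 0], ![0, 1, 0, 0], ![0, 0, 1, 0], ![0, 0, 0, 1]],
    ![![0, 1, 0, 0], ![3, 0, 2, 0], ![0, 2, 0, 3], ![0, 0, 1, 0]],
    ![![0, 0, 1, 0], ![0, 2, 0, 3], ![3, 0, 2, 0], ![0, 1, 0, 0]],
    ![![0, 0, 0, 1], ![0, 0, 1, 0], ![0, 1, 0, 0], ![1, 0, 0, 0]]]
  dual := ![![1, 1, 1, 1], ![3, 1, -1, -3], ![3, -1, -1, 3], ![1, -1, 1, -1]]
  nonempty := by decide +kernel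
  diag := by decide +kernel
  symm := by decide +kernel
  card_eq := by decide +kernel
  dual_zero k := by fin_cases k <;> rfl
  dual_ne_zero i := by fin_cases i <;> norm_num
  sum_dual k := by fin_cases k <;> norm_num [Fin.sum_univ_succ]
  sum_inter i j k := by
    fin_cases i <;> fin_cases j <;> fin_cases k <;> norm_num [Fin.sum_univ_succ]
  poly i := by
    fin_cases i
    · exact ⟨1, by simp, fun k => by fin_cases k <;> simp⟩
    · exact ⟨Polynomial.X, by simp, fun k => by simp⟩
    · exact ⟨Polynomial.C (1 / 2) * Polynomial.X ^ 2 + Polynomial.C 0 * Polynomial.X +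
        Polynomial.C (-3 / 2), Polynomial.degree_quadratic (by norm_num),
        fun k => by fin_cases k <;> norm_num⟩
    · exact ⟨Polynomial.C (1 / 6) * Polynomial.X ^ 3 + Polynomial.C 0 * Polynomial.X ^ 2 +
        Polynomial.C (-7 / 6) * Polynomial.X + Polynomial.C 0,
        Polynomial.degree_cubic (by norm_num), fun k => by fin_cases k <;> norm_num⟩

set_option maxHeartbeats 2000000 in
/-- The scheme of the regular icosahedron; antipodal vertices have the same residue modulo six, and
the vertices from one to five are the neighbours of the vertex zero in cyclic order. -/
noncomputable def icosahedron : SchemeTable 12 3 where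
  rel x y :=
    let a := x.val % 6
    let b := y.val % 6
    -- Adding 5 prevents truncated subtraction, since b ≤ 5; residues 1 and 4 mean adjacency in the
    -- pentagon.
    let r : Fin 4 := if a = b then 0 else if a = 0 ∨ b = 0 ∨ (a + 5 - b) % 5 = 1 ∨
      (a + 5 - b) % 5 = 4 then 1 else 2
    -- Passing to the antipode of one point reverses the four relations.
    if x.val / 6 = y.val / 6 then r else 3 - r
  inter := ![![![1, 0, 0, 0], ![0, 1, 0, 0], ![0, 0, 1, 0], ![0, 0, 0, 1]],
    ![![0, 1, 0, 0], ![5, 2, 2, 0], ![0, 2, 2, 5], ![0, 0, 1, 0]],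
    ![![0, 0, 1, 0], ![0, 2, 2, 5], ![5, 2, 2, 0], ![0, 1, 0, 0]],
    ![![0, 0, 0, 1], ![0, 0, 1, 0], ![0, 1, 0, 0], ![1, 0, 0, 0]]]
  dual := ![![1, 1, 1, 1], ![3, 3 / 5 * √5, -(3 / 5 * √5), -3], ![5, -1, -1, 5],
    ![3, -(3 / 5 * √5), 3 / 5 * √5, -3]]
  nonempty := by decide +kernel
  diag := by decide +kernel
  symm := by decide +kernel
  card_eq := by decide +kernel
  dual_zero k := by fin_cases k <;> rfl
  dual_ne_zero i := by fin_cases i <;> norm_num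
  sum_dual k := by fin_cases k <;> norm_num [Fin.sum_univ_succ]
  sum_inter i j k := by
    have h5 : √(5 : ℝ) ^ 2 = 5 := Real.sq_sqrt (by norm_num)
    fin_cases i <;> fin_cases j <;> fin_cases k <;> simp [Fin.sum_univ_succ] <;> ring_nf <;>
      norm_num [h5]
  poly i := by
    have h5 : √(5 : ℝ) ^ 2 = 5 := Real.sq_sqrt (by norm_num)
    have h6 : √(5 : ℝ) ^ 3 = 5 * √5 := by rw [pow_succ, h5]
    fin_cases i
    · exact ⟨1, by simp, fun k => by fin_cases k <;> simp⟩
    · exact ⟨Polynomial.X, by simp, fun k => by simp⟩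
    · exact ⟨Polynomial.C (5 / 6) * Polynomial.X ^ 2 + Polynomial.C 0 * Polynomial.X +
        Polynomial.C (-5 / 2), Polynomial.degree_quadratic (by norm_num),
        fun k => by fin_cases k <;> simp [mul_pow, h5] <;> norm_num⟩
    · exact ⟨Polynomial.C (5 / 18) * Polynomial.X ^ 3 + Polynomial.C 0 * Polynomial.X ^ 2 +
        Polynomial.C (-3 / 2) * Polynomial.X + Polynomial.C 0,
        Polynomial.degree_cubic (by norm_num), fun k => by
          fin_cases k <;> simp <;> linarith⟩

end SchemeTable

end

theorem corollary1p2 :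
    (∀ (X : Type*) [Fintype X] [DecidableEq X] (d : ℕ) (S : SymmetricAssociationScheme X d)
      (E : Fin (d + 1) → Matrix X X ℝ), S.IsQPolynomial E → (E 1).rank = 3 →
      ∃ P : SchemePolyhedron,
        (P = .tetrahedron ∨ P = .octahedron ∨ P = .cube ∨ P = .icosahedron) ∧
        S.IsRealizedBy (E 1) P) ∧
    (∀ P : SchemePolyhedron,
      (P = .tetrahedron ∨ P = .octahedron ∨ P = .cube ∨ P = .icosahedron) →
      ∃ (n d : ℕ) (S : SymmetricAssociationScheme (Fin n) d)
        (E : Fin (d + 1) → Matrix (Fin n) (Fin n) ℝ),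
        S.IsQPolynomial E ∧ (E 1).rank = 3 ∧ S.IsRealizedBy (E 1) P) := by
  refine ⟨fun X _ _ d S E h h3 => ?_, ?_⟩
  · obtain ⟨P, t, hPt, hP, -⟩ := h.exists_isRealizedBy h3
    exact ⟨P, hPt.imp And.left (Or.imp And.left (Or.imp And.left And.left)), hP⟩
  · rintro P (rfl | rfl | rfl | rfl)
    -- In each table relation 1 is the edge relation, which attains t.
    · refine SchemeTable.tetrahedron.exists_realization rfl (t := -1 / 3) (by simp) ?_ ⟨1, ?_⟩
      · intro k hk
        fin_cases k <;> simp_all [SchemeTable.tetrahedron]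
      · simp [SchemeTable.tetrahedron]
    · refine SchemeTable.octahedron.exists_realization rfl (t := 0) (by simp) ?_ ⟨1, ?_⟩
      · intro k hk
        fin_cases k <;> simp_all [SchemeTable.octahedron]
      · simp [SchemeTable.octahedron]
    · refine SchemeTable.cube.exists_realization rfl (t := 1 / 3) (by simp) ?_ ⟨1, ?_⟩
      · intro k hk
        fin_cases k <;> simp_all [SchemeTable.cube] <;> norm_num
      · simp [SchemeTable.cube]
    · refine SchemeTable.icosahedron.exists_realization rfl (t := √5 / 5) (by simp) ?_ ⟨1, ?_⟩
      · intro k hk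
        fin_cases k <;> simp_all [SchemeTable.icosahedron] <;>
          linarith [Real.sqrt_nonneg (5 : ℝ)]
      · simp [SchemeTable.icosahedron]
        ring
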